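/- Let $\mathcal F u(p)=\int_{\mathbb R}u(x)e^{-ixp}\,dx$ denote the Fourier transform, extended to tempered distributions by duality. Let $\mu\in(0,1]$ and $p_1<p_2$ be real numbers, and let $u_0\in\mathcal S'(\mathbb R)$ satisfy Condition $(C_{[p_1,p_2],\mu})$: the support of $\mathcal F u_0$ equals $[p_1,p_2]$, and $\mathcal F u_0$ is a function on $(p_1,p_2]$ of the form $$\mathcal F u_0(p)=(p-p_1)^{\mu-1}\,\tilde u(p),\qquad p\in(p_1,p_2],$$ where $\tilde u:[p_1,p_2]\to\mathbb C$ is continuous on $[p_1,p_2]$ and differentiable on $(p_1,p_2)$ with $\tilde u'\in L^1(p_1,p_2)$, and $\tilde u(p_1)\neq0$ if $\mu\neq1$. Let $u_S$ be the solution, in the space of tempered distributions, of the free Schrödinger equation $$i\,\partial_t u=f(D)u=-\partial_x^2u\quad(t>0),\qquad u(0,\cdot)=u_0,$$ with symbol $f(p)=p^2$; that is, $t\mapsto u_S(t,\cdot)\in\mathcal S'(\mathbb R)$ is weak-* continuous on $[0,\infty)$ with $u_S(0,\cdot)=u_0$, and the equation holds for $t>0$ when tested against every Schwartz function. Then $u_S(t,\cdot)\in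 L^\infty(\mathbb R)$ for every $t>0$, and the following hold. (i) For all real $\tilde p_1<p_1$ and $\tilde p_2>p_2$, $$\forall\,t\ge1\qquad \|u_S(t,\cdot)\|_{L^\infty(\mathbb R)}\le c(u_0)\,t^{-\mu/2},$$ where, with $M=\|\tilde u\|_{L^\infty(p_1,p_2)}$ and $N=\|\tilde u'\|_{L^1(p_1,p_2)}$, $$c(u_0)=\frac{3M}{2\pi\mu}+\frac{4M+N}{2\pi}+\frac{M}{\pi\mu}+\frac{4M+N}{2\pi}\left(\frac1{2(\tilde p_2-p_2)}+\frac1{2(p_1-\tilde p_1)}\right)>0 .$$ (ii) The decay rate $t^{-\mu/2}$ is optimal: there is a constant $c'(u_0)>0$ such that $$\forall\,t\ge1\qquad \|u_S(t,\cdot)\|_{L^\infty(\mathbb R)}\ge c'(u_0)\,t^{-\mu/2}.$$ -/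

import Mathlib

open MeasureTheory SchwartzMap Set
open scoped ENNReal

noncomputable section

namespace FreeSchrodinger

/-- The Fourier transform `(𝓕 φ)(p) = ∫ φ(x) e^{-ixp} dx` on the Schwartz space. Mathlib's transform
has the kernel `e^{-2πixp}`, so it is rescaled by `p ↦ p / (2π)`. -/
def angularFourierCLM : 𝓢(ℝ, ℂ) →L[ℂ] 𝓢(ℝ, ℂ) :=
  (SchwartzMap.compCLMOfContinuousLinearEquiv ℂ
      (ContinuousLinearEquiv.unitsEquivAut ℝ
        (Units.mk0 ((2 * Real.pi)⁻¹ : ℝ) (inv_ne_zero Real.two_pi_pos.ne')))) ∘L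
    (FourierTransform.fourierCLM ℂ 𝓢(ℝ, ℂ))

theorem angularFourierCLM_apply (φ : 𝓢(ℝ, ℂ)) (p : ℝ) :
    angularFourierCLM φ p = ∫ x : ℝ, φ x * Complex.exp (-(Complex.I * x * p)) := by
  have h : angularFourierCLM φ p
      = (FourierTransform.fourier (φ : ℝ → ℂ)) (p * (2 * Real.pi)⁻¹) := by
    rw [← SchwartzMap.fourier_coe]
    rfl
  rw [h, Real.fourier_eq']
  refine integral_congr_ae (Filter.Eventually.of_forall fun x => ?_)
  have hpi : (Real.pi : ℂ) ≠ 0 := by exact_mod_cast Real.pi_ne_zero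
  simp only [smul_eq_mul]
  rw [mul_comm]
  congr 2
  simp
  field_simp

/-- The Fourier transform of a tempered distribution, by duality:
`⟨𝓕 T, φ⟩ = ⟨T, 𝓕 φ⟩`. -/
def angularFourier (T : 𝓢'(ℝ, ℂ)) : 𝓢'(ℝ, ℂ) :=
  PointwiseConvergenceCLM.precomp ℂ angularFourierCLM T

/-- `ut` is the regular part of an amplitude `U : (p₁, p₂] → ℂ` with a singularity of strength
`μ - 1` at `p₁`: on `(p₁, p₂]` one has `U(p) = (p - p₁)^(μ - 1) ut(p)`, where `ut` is continuous
on `[p₁, p₂]`, differentiable on `(p₁, p₂)` with integrable derivative, and `ut(p₁) ≠ 0`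
if `μ ≠ 1`. -/
structure IsRegularPart (p₁ p₂ μ : ℝ) (U ut : ℝ → ℂ) : Prop where
  factor : ∀ p ∈ Ioc p₁ p₂, U p = (((p - p₁) ^ (μ - 1) : ℝ) : ℂ) * ut p
  continuousOn : ContinuousOn ut (Icc p₁ p₂)
  differentiableOn : DifferentiableOn ℝ ut (Ioo p₁ p₂)
  integrableOn_deriv : IntegrableOn (deriv ut) (Ioo p₁ p₂)
  ne_zero : μ ≠ 1 → ut p₁ ≠ 0

/-- The frequency band condition on the initial datum `u₀`: the support of `𝓕 u₀` is `[p₁, p₂]`,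
and `𝓕 u₀` is (integration against) a function on `(p₁, p₂]` whose regular part is `ut`. -/
structure BandCondition (p₁ p₂ μ : ℝ) (u₀ : 𝓢'(ℝ, ℂ)) (ut : ℝ → ℂ) : Prop where
  support_eq : Distribution.dsupport (angularFourier u₀) = Icc p₁ p₂
  exists_amplitude : ∃ U : ℝ → ℂ, IsRegularPart p₁ p₂ μ U ut ∧
    ∀ φ : 𝓢(ℝ, ℂ), angularFourier u₀ φ = ∫ p in Ioc p₁ p₂, U p * φ p

/-- `u` solves the free Schrödinger equation `i ∂ₜ u = f(D) u = -∂ₓ² u` (`f(p) = p²`) for `t > 0`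
with `u(0) = u₀`, in the space of tempered distributions with its pointwise (weak-*) topology:
`t ↦ u(t)` is continuous on `[0, ∞)` and `∂ₜ u = i ∂ₓ² u` on `(0, ∞)`. (Iterating the equation
shows that `u` is then automatically of class `C^∞` on `[0, ∞)`.) Negative times are irrelevant. -/
structure IsSolution (u₀ : 𝓢'(ℝ, ℂ)) (u : ℝ → 𝓢'(ℝ, ℂ)) : Prop where
  initial : u 0 = u₀
  continuousOn : ContinuousOn u (Ici 0)
  equation : ∀ t : ℝ, 0 < t → ∀ φ : 𝓢(ℝ, ℂ),
    HasDerivAt (fun s : ℝ => u s φ)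
      (Complex.I * TemperedDistribution.derivCLM ℂ (TemperedDistribution.derivCLM ℂ (u t)) φ) t

/-- `‖ut‖` in `L^∞(p₁, p₂)`. -/
def supNorm (p₁ p₂ : ℝ) (ut : ℝ → ℂ) : ℝ :=
  (eLpNorm ut ∞ (volume.restrict (Ioo p₁ p₂))).toReal

/-- `‖ut'‖` in `L^1(p₁, p₂)`. -/
def derivNorm (p₁ p₂ : ℝ) (ut : ℝ → ℂ) : ℝ :=
  ∫ p in Ioo p₁ p₂, ‖deriv ut p‖

/-- The constant for the inside of the cone; the last factor is `(min f'')⁻¹` for `f(p) = p²`. -/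
def constInside (p₁ p₂ μ : ℝ) (ut : ℝ → ℂ) : ℝ :=
  1 / (2 * Real.pi) * (3 / μ) * supNorm p₁ p₂ ut
    + 1 / Real.pi * (4 * supNorm p₁ p₂ ut + derivNorm p₁ p₂ ut) * (2 : ℝ)⁻¹

/-- The constant for one of the two sides outside the cone, `m` being the lower bound there of the
derivative of the phase. -/
def constSide (p₁ p₂ μ : ℝ) (ut : ℝ → ℂ) (m : ℝ) : ℝ :=
  1 / (2 * Real.pi) * (1 / μ) * supNorm p₁ p₂ ut
    + 1 / (2 * Real.pi) * (4 * supNorm p₁ p₂ ut + derivNorm p₁ p₂ ut) * m⁻¹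

/-- The constant `c(u₀)` for the band `[p₁, p₂]` inside the larger band `[q₁, q₂]`, for
`f(p) = p²`, where `f'(q₂) - f'(p₂) = 2 (q₂ - p₂)` and `f'(p₁) - f'(q₁) = 2 (p₁ - q₁)`. -/
def decayConst (p₁ p₂ q₁ q₂ μ : ℝ) (ut : ℝ → ℂ) : ℝ :=
  constInside p₁ p₂ μ ut
    + (constSide p₁ p₂ μ ut (2 * (q₂ - p₂)) + constSide p₁ p₂ μ ut (2 * (p₁ - q₁)))

end FreeSchrodinger

end

/-! On the Fourier side the equation reads `∂ₜv = -ip²v`, so the pairing of `v(s)` with `e^{isp²}ψ`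
should be constant in `s`. Differentiating it moves the distribution and the test function together.
The product rule then rests on Banach–Steinhaus, hence on completeness of the Schwartz space. This
gives `angularFourier_solution_apply`, and by Fubini the solution at time `t` is the function
`(2π)⁻¹ ∫ (p-p₁)^(μ-1) ut(p) e^{-itp²+ixp} dp` over the band (`toTemperedDistribution_wave`).

Upper bound: completing the square turns the phase into `-t(p-p₀)²` with `p₀ = x/(2t)`. At scale `δ
= t^(-1/2)`, the parts within `δ` of `p₁` or of `p₀` are bounded by size and the rest by integration
by parts (`norm_oscillatory_integral_le`). The result is uniform in `p₀`, hence in `x`, so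
`constInside` alone suffices and the side constants only enlarge it.

Lower bound: the wave is tested against a modulated Gaussian of complex width
(`norm_gaussian_mean_le`). The imaginary part of the width is chosen to cancel `e^{-itp²}`, which
leaves a real Gaussian mean of the amplitude around a point `q` with `ut q ≠ 0`. Laplace's method
gives this mean the size `t^(-μ/2)` (`exists_gaussian_mean_lower_bound`). Here `q = p₁` if `μ ≠ 1`,
and `q` is an interior point if `μ = 1`. -/

noncomputable section

namespace FreeSchrodinger

open Filter Topology

/-! ### Completeness of the Schwartz space and Banach–Steinhaus. -/

section SchwartzCompleteness

theorem seminorm_sub_lt_of_cauchySeq {f : ℕ → 𝓢(ℝ, ℂ)} (hf : CauchySeq f) (k m : ℕ) {ε : ℝ}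
    (hε : 0 < ε) :
    ∃ N, ∀ i ≥ N, ∀ j ≥ N, SchwartzMap.seminorm ℝ k m (f j - f i) < ε := by
  have h1 : Tendsto (fun q : ℕ × ℕ => f q.2 - f q.1) atTop (𝓝 0) := by
    have := cauchySeq_iff_tendsto.1 hf
    rw [uniformity_eq_comap_nhds_zero, tendsto_comap_iff] at this
    exact this
  have h2 : Tendsto (fun q : ℕ × ℕ => SchwartzMap.seminorm ℝ k m (f q.2 - f q.1)) atTop (𝓝 0) := by
    have := (((schwartz_withSeminorms ℝ ℝ ℂ).continuous_seminorm (k, m)).tendsto 0).comp h1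
    rwa [map_zero] at this
  obtain ⟨⟨a, b⟩, hN⟩ := eventually_atTop.1 (h2.eventually_lt_const hε)
  exact ⟨max a b, fun i hi j hj =>
    hN (i, j) ⟨(le_max_left _ _).trans hi, (le_max_right _ _).trans hj⟩⟩

theorem iteratedDeriv_sub_apply (f g : 𝓢(ℝ, ℂ)) (m : ℕ) (x : ℝ) :
    iteratedDeriv m (f - g) x = iteratedDeriv m f x - iteratedDeriv m g x :=
  iteratedDeriv_sub (f.contDiffAt m) (g.contDiffAt m)

theorem exists_iteratedDeriv_limit {f : ℕ → 𝓢(ℝ, ℂ)} (hf : CauchySeq f) (m : ℕ) :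
    ∃ g : ℝ → ℂ, TendstoUniformly (fun i => iteratedDeriv m (f i)) g atTop := by
  have hc : UniformCauchySeqOn (fun i => iteratedDeriv m (f i)) atTop univ := by
    rw [Metric.uniformCauchySeqOn_iff]
    intro ε hε
    obtain ⟨N, hN⟩ := seminorm_sub_lt_of_cauchySeq hf 0 m hε
    refine ⟨N, fun i hi j hj x _ => ?_⟩
    have := SchwartzMap.le_seminorm' ℝ 0 m (f i - f j) x
    rw [iteratedDeriv_sub_apply, pow_zero, one_mul] at this
    rw [dist_eq_norm]
    exact this.trans_lt (hN j hj i hi)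
  have hp : ∀ x, ∃ y, Tendsto (fun i => iteratedDeriv m (f i) x) atTop (𝓝 y) := fun x =>
    cauchySeq_tendsto_of_complete (hc.cauchySeq (mem_univ x))
  choose g hg using hp
  refine ⟨g, ?_⟩
  rw [← tendstoUniformlyOn_univ]
  exact hc.tendstoUniformlyOn_of_tendsto fun x _ => hg x

/-- The topology has countably many seminorms, so sequences suffice. All derivatives converge
uniformly, so the limits `g m` are successive derivatives of `g 0`; the weighted Cauchy estimates
pass to the limit and give both decay and convergence. -/
instance completeSpace_schwartzMap : CompleteSpace 𝓢(ℝ, ℂ) := by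
  have : (uniformity 𝓢(ℝ, ℂ)).IsCountablyGenerated :=
    IsUniformAddGroup.uniformity_countably_generated
  refine UniformSpace.complete_of_cauchySeq_tendsto fun f hf => ?_
  choose g hg using exists_iteratedDeriv_limit hf
  have hd : ∀ m x, HasDerivAt (g m) (g (m + 1) x) x := fun m =>
    hasDerivAt_of_tendstoUniformly (hg (m + 1))
      (Eventually.of_forall fun i x => by
        rw [iteratedDeriv_succ]
        exact (((f i).smooth (⊤ : ℕ∞)).differentiable_iteratedDeriv m
          (by exact_mod_cast WithTop.coe_lt_top m)).differentiableAt.hasDerivAt)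
      (fun x => (hg m).tendsto_at x)
  have hit : ∀ m, iteratedDeriv m (g 0) = g m := by
    intro m
    induction m with
    | zero => exact iteratedDeriv_zero
    | succ m ih =>
      rw [iteratedDeriv_succ, ih]
      exact funext fun x => (hd m x).deriv
  have hsm : ContDiff ℝ (⊤ : ℕ∞) (g 0) :=
    contDiff_of_differentiable_iteratedDeriv fun m _ => by
      rw [hit]
      exact fun x => (hd m x).differentiableAt
  have hlim : ∀ k m (ε : ℝ), 0 < ε → ∃ N, ∀ i ≥ N, ∀ x,
      |x| ^ k * ‖iteratedDeriv m (f i) x - g m x‖ ≤ ε := by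
    intro k m ε hε
    obtain ⟨N, hN⟩ := seminorm_sub_lt_of_cauchySeq hf k m hε
    refine ⟨N, fun i hi x => ?_⟩
    -- Fix `i` and let `j → ∞` in the Cauchy estimate.
    have ht : Tendsto (fun j => |x| ^ k * ‖iteratedDeriv m (f i) x - iteratedDeriv m (f j) x‖)
        atTop (𝓝 (|x| ^ k * ‖iteratedDeriv m (f i) x - g m x‖)) :=
      (((hg m).tendsto_at x).const_sub _).norm.const_mul _
    refine le_of_tendsto ht (eventually_atTop.2 ⟨N, fun j hj => ?_⟩)
    have := SchwartzMap.le_seminorm' ℝ k m (f i - f j) x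
    rw [iteratedDeriv_sub_apply] at this
    exact this.trans (hN j hj i hi).le
  have hdec : ∀ k m : ℕ, ∃ C : ℝ, ∀ x, ‖x‖ ^ k * ‖iteratedFDeriv ℝ m (g 0) x‖ ≤ C := by
    intro k m
    obtain ⟨N, hN⟩ := hlim k m 1 one_pos
    refine ⟨1 + SchwartzMap.seminorm ℝ k m (f N), fun x => ?_⟩
    rw [norm_iteratedFDeriv_eq_norm_iteratedDeriv, hit]
    have h1 := hN N le_rfl x
    have h2 := SchwartzMap.le_seminorm' ℝ k m (f N) x
    have h3 : ‖g m x‖ ≤ ‖iteratedDeriv m (f N) x - g m x‖ + ‖iteratedDeriv m (f N) x‖ := by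
      have := norm_sub_le (iteratedDeriv m (f N) x) (iteratedDeriv m (f N) x - g m x)
      rw [sub_sub_cancel] at this
      linarith
    have h4 := mul_le_mul_of_nonneg_left h3 (pow_nonneg (abs_nonneg x) k)
    rw [Real.norm_eq_abs]
    linarith
  refine ⟨⟨g 0, hsm, hdec⟩, ?_⟩
  rw [(schwartz_withSeminorms ℝ ℝ ℂ).tendsto_nhds]
  rintro ⟨k, m⟩ ε hε
  obtain ⟨N, hN⟩ := hlim k m (ε / 2) (by positivity)
  refine eventually_atTop.2 ⟨N, fun i hi => ?_⟩
  refine lt_of_le_of_lt (SchwartzMap.seminorm_le_bound' ℝ k m _ (by positivity) fun x => ?_)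
    (half_lt_self hε)
  rw [iteratedDeriv_sub_apply]
  have : iteratedDeriv m (⇑(⟨g 0, hsm, hdec⟩ : 𝓢(ℝ, ℂ))) x = g m x := congrFun (hit m) x
  rw [this]
  exact hN i hi x

instance baireSpace_schwartzMap : BaireSpace 𝓢(ℝ, ℂ) := by
  have : (uniformity 𝓢(ℝ, ℂ)).IsCountablyGenerated :=
    IsUniformAddGroup.uniformity_countably_generated
  infer_instance

/-- The Banach–Steinhaus theorem for tempered distributions, in the form used here: along a
pointwise bounded family, pairings with test functions tending to `0` tend to `0`. -/
theorem tendsto_apply_zero_of_pointwise_bounded {ι κ : Type*} {v : ι → 𝓢(ℝ, ℂ) →L[ℂ] ℂ}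
    (hv : ∀ φ, ∃ C, ∀ i, ‖v i φ‖ ≤ C) {l : Filter κ} {i : κ → ι} {χ : κ → 𝓢(ℝ, ℂ)}
    (hχ : Tendsto χ l (𝓝 0)) : Tendsto (fun s => v (i s) (χ s)) l (𝓝 0) := by
  have hbs : UniformEquicontinuous ((↑) ∘ v) :=
    (norm_withSeminorms ℂ ℂ).banach_steinhaus (𝓕 := v) fun _ φ => by
      obtain ⟨C, hC⟩ := hv φ
      exact ⟨C, by rintro _ ⟨i, rfl⟩; exact hC i⟩
  have h0 := hbs.equicontinuous 0
  rw [Metric.equicontinuousAt_iff_right] at h0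
  rw [Metric.tendsto_nhds]
  intro ε hε
  filter_upwards [hχ.eventually (h0 ε hε)] with s hs
  have := hs (i s)
  simpa [dist_comm] using this

end SchwartzCompleteness

/-! ### The multipliers `e^{isp²}` on the Schwartz space and their derivative at `s = 0`. -/

section Multipliers

theorem hasDerivAt_cexp_I_mul (y : ℝ) :
    HasDerivAt (fun y : ℝ => Complex.exp (Complex.I * y)) (Complex.I * Complex.exp (Complex.I * y))
      y := by
  have h : HasDerivAt (fun y : ℝ => Complex.I * (y : ℂ)) Complex.I y := by
    simpa using (Complex.ofRealCLM.hasDerivAt (x := y)).const_mul Complex.I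
  simpa [mul_comm] using h.cexp

theorem hasTemperateGrowth_cexp_I_mul :
    Function.HasTemperateGrowth (fun y : ℝ => Complex.exp (Complex.I * y)) := by
  have hit : ∀ n : ℕ, iteratedDeriv n (fun y : ℝ => Complex.exp (Complex.I * y))
      = fun y : ℝ => Complex.I ^ n * Complex.exp (Complex.I * y) := by
    intro n
    induction n with
    | zero => simp
    | succ n ih =>
      rw [iteratedDeriv_succ, ih]
      funext y
      rw [((hasDerivAt_cexp_I_mul y).const_mul _).deriv]
      ring
  refine ⟨?_, fun n => ⟨0, 1, fun y => ?_⟩⟩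
  · refine Complex.contDiff_exp.comp (contDiff_const.mul Complex.ofRealCLM.contDiff)
  · rw [norm_iteratedFDeriv_eq_norm_iteratedDeriv, hit]
    simp [Complex.norm_exp]

/-- The multiplier `e^{isp²}`. -/
def chirp (s p : ℝ) : ℂ := Complex.exp (Complex.I * ((s * p ^ 2 : ℝ) : ℂ))

theorem norm_chirp (s p : ℝ) : ‖chirp s p‖ = 1 := by
  rw [chirp, mul_comm, Complex.norm_exp_ofReal_mul_I]

theorem chirp_add (s r p : ℝ) : chirp (s + r) p = chirp s p * chirp r p := by
  rw [chirp, chirp, chirp, ← Complex.exp_add]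
  congr 1
  push_cast
  ring

theorem chirp_zero (p : ℝ) : chirp 0 p = 1 := by simp [chirp]

theorem continuous_chirp (s : ℝ) : Continuous (chirp s) := by
  unfold chirp
  fun_prop

theorem hasTemperateGrowth_chirp (s : ℝ) : Function.HasTemperateGrowth (chirp s) :=
  hasTemperateGrowth_cexp_I_mul.comp
    ((Function.HasTemperateGrowth.const s).mul (Function.HasTemperateGrowth.id'.pow 2))

theorem hasDerivAt_chirp (s p : ℝ) :
    HasDerivAt (chirp s) (2 * Complex.I * s * p * chirp s p) p := by
  have h : HasDerivAt (fun p : ℝ => s * p ^ 2) (s * (2 * p)) p := by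
    simpa using (hasDerivAt_pow 2 p).const_mul s
  have := (hasDerivAt_cexp_I_mul (s * p ^ 2)).scomp p h
  refine this.congr_deriv ?_
  rw [chirp, Complex.real_smul]
  push_cast
  ring

/-- Multiplication by `e^{isp²}` on the Schwartz space. -/
def chirpCLM (s : ℝ) : 𝓢(ℝ, ℂ) →L[ℂ] 𝓢(ℝ, ℂ) := smulLeftCLM ℂ (chirp s)

theorem chirpCLM_apply (s : ℝ) (φ : 𝓢(ℝ, ℂ)) (p : ℝ) : chirpCLM s φ p = chirp s p * φ p :=
  smulLeftCLM_apply_apply (hasTemperateGrowth_chirp s) φ p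

theorem chirpCLM_add (s r : ℝ) (φ : 𝓢(ℝ, ℂ)) : chirpCLM (s + r) φ = chirpCLM r (chirpCLM s φ) := by
  ext p
  simp only [chirpCLM_apply, chirp_add]
  ring

theorem chirpCLM_zero (φ : 𝓢(ℝ, ℂ)) : chirpCLM 0 φ = φ := by
  ext p
  simp [chirpCLM_apply, chirp_zero]

/-- Multiplication by the coordinate on the Schwartz space. -/
def coordCLM : 𝓢(ℝ, ℂ) →L[ℂ] 𝓢(ℝ, ℂ) := smulLeftCLM ℂ (fun p : ℝ => (p : ℂ))

theorem coordCLM_apply (φ : 𝓢(ℝ, ℂ)) (p : ℝ) : coordCLM φ p = p * φ p :=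
  smulLeftCLM_apply_apply Function.Complex.hasTemperateGrowth_ofReal φ p

theorem seminorm_succ_le (k n : ℕ) (φ : 𝓢(ℝ, ℂ)) :
    SchwartzMap.seminorm ℂ k (n + 1) φ ≤ SchwartzMap.seminorm ℂ k n (derivCLM ℂ ℂ φ) := by
  refine SchwartzMap.seminorm_le_bound' ℂ k (n + 1) φ (apply_nonneg _ _) fun x => ?_
  rw [iteratedDeriv_succ']
  exact SchwartzMap.le_seminorm' ℂ k n (derivCLM ℂ ℂ φ) x

/-- The commutator carries a factor `s`; this is what lets the estimates below run by induction on
the number of derivatives. -/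
theorem derivCLM_chirpCLM (s : ℝ) (φ : 𝓢(ℝ, ℂ)) :
    derivCLM ℂ ℂ (chirpCLM s φ)
      = chirpCLM s (derivCLM ℂ ℂ φ) + (2 * Complex.I * s) • chirpCLM s (coordCLM φ) := by
  ext p
  have h := (hasDerivAt_chirp s p).mul (φ.hasDerivAt p)
  have h2 : (⇑(chirpCLM s φ) : ℝ → ℂ) = chirp s * ⇑φ := funext fun p => chirpCLM_apply s φ p
  rw [SchwartzMap.derivCLM_apply, h2, h.deriv]
  simp only [_root_.add_apply, _root_.smul_apply, chirpCLM_apply, coordCLM_apply,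
    SchwartzMap.derivCLM_apply, smul_eq_mul]
  ring

theorem derivCLM_coordCLM (φ : 𝓢(ℝ, ℂ)) :
    derivCLM ℂ ℂ (coordCLM φ) = φ + coordCLM (derivCLM ℂ ℂ φ) := by
  ext p
  have h := (Complex.ofRealCLM.hasDerivAt (x := p)).mul (φ.hasDerivAt p)
  have h2 : (⇑(coordCLM φ) : ℝ → ℂ) = ⇑Complex.ofRealCLM * ⇑φ :=
    funext fun p => coordCLM_apply φ p
  rw [SchwartzMap.derivCLM_apply, h2, h.deriv]
  simp only [_root_.add_apply, coordCLM_apply, SchwartzMap.derivCLM_apply]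
  simp

theorem norm_chirp_sub_one_le (h p : ℝ) : ‖chirp h p - 1‖ ≤ |h| * |p| ^ 2 := by
  have := Real.norm_exp_I_mul_ofReal_sub_one_le (x := h * p ^ 2)
  simpa [chirp, abs_mul] using this

theorem norm_chirp_sub_one_sub_le (h p : ℝ) :
    ‖chirp h p - 1 - Complex.I * h * p ^ 2‖ ≤ 2 * (|h| ^ 2 * |p| ^ 4) := by
  have e : |h| ^ 2 * |p| ^ 4 = |h * p ^ 2| ^ 2 := by
    rw [abs_mul, abs_pow]
    ring
  have hy : chirp h p - 1 - Complex.I * h * p ^ 2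
      = Complex.exp (Complex.I * ((h * p ^ 2 : ℝ) : ℂ)) - 1 - Complex.I * ((h * p ^ 2 : ℝ) : ℂ) := by
    rw [chirp]
    push_cast
    ring
  rw [e, hy]
  set y : ℝ := h * p ^ 2
  have hn : ‖Complex.I * (y : ℂ)‖ = |y| := by simp
  -- Taylor's estimate needs `|y| ≤ 1`; for `|y| ≥ 1` the trivial bound `2|y|` is at most `2|y|²`.
  rcases le_total |y| 1 with h1 | h1
  · have := Complex.norm_exp_sub_one_sub_id_le (x := Complex.I * y) (by rwa [hn])
    rw [hn] at this
    nlinarith [sq_nonneg |y|]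
  · have h2 := Real.norm_exp_I_mul_ofReal_sub_one_le (x := y)
    have h3 := norm_sub_le (Complex.exp (Complex.I * y) - 1) (Complex.I * y)
    rw [hn] at h3
    rw [Real.norm_eq_abs] at h2
    nlinarith

/-- Without derivatives, `|e^{ihp²} - 1| ≤ |h|p²` costs two powers of the weight. A further
derivative leads to the same quantity for `φ'` and, with a factor `h`, for `pφ`; hence the induction
over all `φ`. -/
theorem tendsto_seminorm_chirpCLM_sub (k n : ℕ) (φ : 𝓢(ℝ, ℂ)) :
    Tendsto (fun h : ℝ => SchwartzMap.seminorm ℂ k n (chirpCLM h φ - φ)) (𝓝 0) (𝓝 0) := by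
  induction n generalizing φ with
  | zero =>
    have hb : ∀ h : ℝ, SchwartzMap.seminorm ℂ k 0 (chirpCLM h φ - φ)
        ≤ |h| * SchwartzMap.seminorm ℂ (k + 2) 0 φ := by
      intro h
      refine SchwartzMap.seminorm_le_bound' ℂ k 0 _ (by positivity) fun x => ?_
      rw [iteratedDeriv_zero, _root_.sub_apply, chirpCLM_apply]
      have h1 := SchwartzMap.norm_pow_mul_le_seminorm ℂ φ (k + 2) x
      rw [Real.norm_eq_abs] at h1
      have h2 := norm_chirp_sub_one_le h x
      calc |x| ^ k * ‖chirp h x * φ x - φ x‖ = |x| ^ k * (‖chirp h x - 1‖ * ‖φ x‖) := by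
            rw [← norm_mul, sub_mul, one_mul]
        _ ≤ |x| ^ k * ((|h| * |x| ^ 2) * ‖φ x‖) := by gcongr
        _ = |h| * (|x| ^ (k + 2) * ‖φ x‖) := by ring
        _ ≤ _ := by gcongr
    refine squeeze_zero (fun h => apply_nonneg _ _) hb ?_
    have : Tendsto (fun h : ℝ => |h| * SchwartzMap.seminorm ℂ (k + 2) 0 φ) (𝓝 0)
        (𝓝 (|0| * SchwartzMap.seminorm ℂ (k + 2) 0 φ)) := (continuous_abs.tendsto 0).mul_const _
    simpa using this
  | succ n ih =>
    have hb : ∀ h : ℝ, SchwartzMap.seminorm ℂ k (n + 1) (chirpCLM h φ - φ)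
        ≤ SchwartzMap.seminorm ℂ k n (chirpCLM h (derivCLM ℂ ℂ φ) - derivCLM ℂ ℂ φ)
          + 2 * |h| * (SchwartzMap.seminorm ℂ k n (chirpCLM h (coordCLM φ) - coordCLM φ)
            + SchwartzMap.seminorm ℂ k n (coordCLM φ)) := by
      intro h
      refine (seminorm_succ_le k n _).trans ?_
      have e : derivCLM ℂ ℂ (chirpCLM h φ - φ)
          = (chirpCLM h (derivCLM ℂ ℂ φ) - derivCLM ℂ ℂ φ)
            + (2 * Complex.I * h) • ((chirpCLM h (coordCLM φ) - coordCLM φ) + coordCLM φ) := by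
        rw [map_sub, derivCLM_chirpCLM, sub_add_cancel]
        abel
      rw [e]
      refine (map_add_le_add _ _ _).trans (add_le_add le_rfl ?_)
      rw [map_smul_eq_mul]
      have : ‖2 * Complex.I * (h : ℂ)‖ = 2 * |h| := by simp
      rw [this]
      exact mul_le_mul_of_nonneg_left (map_add_le_add _ _ _) (by positivity)
    refine squeeze_zero (fun h => apply_nonneg _ _) hb ?_
    have h1 := (ih (derivCLM ℂ ℂ φ)).add ((((continuous_abs.tendsto (0 : ℝ)).const_mul 2)).mul
      ((ih (coordCLM φ)).add_const (SchwartzMap.seminorm ℂ k n (coordCLM φ))))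
    simpa using h1

/-- The second-order Taylor bound costs four powers of the weight. Differentiating the slope error
gives the slope error of `φ'` plus `2i(e^{ihp²} - 1)pφ`, which the preceding lemma controls. -/
theorem tendsto_seminorm_chirpCLM_slope (k n : ℕ) (φ : 𝓢(ℝ, ℂ)) :
    Tendsto (fun h : ℝ => SchwartzMap.seminorm ℂ k n
      ((h : ℂ)⁻¹ • (chirpCLM h φ - φ) - Complex.I • coordCLM (coordCLM φ))) (𝓝[≠] 0) (𝓝 0) := by
  induction n generalizing φ with
  | zero =>
    have hb : ∀ h : ℝ, h ≠ 0 → SchwartzMap.seminorm ℂ k 0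
        ((h : ℂ)⁻¹ • (chirpCLM h φ - φ) - Complex.I • coordCLM (coordCLM φ))
        ≤ |h| * (2 * SchwartzMap.seminorm ℂ (k + 4) 0 φ) := by
      intro h h0
      refine SchwartzMap.seminorm_le_bound' ℂ k 0 _ (by positivity) fun x => ?_
      rw [iteratedDeriv_zero, _root_.sub_apply, _root_.smul_apply, _root_.smul_apply,
        _root_.sub_apply, chirpCLM_apply, coordCLM_apply, coordCLM_apply]
      have h1 := SchwartzMap.norm_pow_mul_le_seminorm ℂ φ (k + 4) x
      rw [Real.norm_eq_abs] at h1
      have h2 := norm_chirp_sub_one_sub_le h x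
      have h0' : (h : ℂ) ≠ 0 := by exact_mod_cast h0
      have h3 : (h : ℂ)⁻¹ • (chirp h x * φ x - φ x) - Complex.I • ((x : ℂ) * (x * φ x))
          = (h : ℂ)⁻¹ * ((chirp h x - 1 - Complex.I * h * x ^ 2) * φ x) := by
        simp only [smul_eq_mul]
        field_simp
      have hpos : 0 < |h| := abs_pos.2 h0
      calc |x| ^ k * ‖(h : ℂ)⁻¹ • (chirp h x * φ x - φ x) - Complex.I • ((x : ℂ) * (x * φ x))‖
          = |x| ^ k * (|h|⁻¹ * (‖chirp h x - 1 - Complex.I * h * x ^ 2‖ * ‖φ x‖)) := by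
            rw [h3, norm_mul, norm_mul, norm_inv, Complex.norm_real, Real.norm_eq_abs]
        _ ≤ |x| ^ k * (|h|⁻¹ * ((2 * (|h| ^ 2 * |x| ^ 4)) * ‖φ x‖)) := by gcongr
        _ = |h| * (2 * (|x| ^ (k + 4) * ‖φ x‖)) := by field_simp; ring
        _ ≤ _ := by gcongr
    refine squeeze_zero' (Eventually.of_forall fun h => apply_nonneg _ _)
      (eventually_mem_nhdsWithin.mono fun h hh => hb h hh) ?_
    have : Tendsto (fun h : ℝ => |h| * (2 * SchwartzMap.seminorm ℂ (k + 4) 0 φ)) (𝓝 0)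
        (𝓝 (|0| * (2 * SchwartzMap.seminorm ℂ (k + 4) 0 φ))) := (continuous_abs.tendsto 0).mul_const _
    rw [abs_zero, zero_mul] at this
    exact this.mono_left nhdsWithin_le_nhds
  | succ n ih =>
    have hb : ∀ h : ℝ, h ≠ 0 → SchwartzMap.seminorm ℂ k (n + 1)
        ((h : ℂ)⁻¹ • (chirpCLM h φ - φ) - Complex.I • coordCLM (coordCLM φ))
        ≤ SchwartzMap.seminorm ℂ k n ((h : ℂ)⁻¹ • (chirpCLM h (derivCLM ℂ ℂ φ) - derivCLM ℂ ℂ φ)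
            - Complex.I • coordCLM (coordCLM (derivCLM ℂ ℂ φ)))
          + 2 * SchwartzMap.seminorm ℂ k n (chirpCLM h (coordCLM φ) - coordCLM φ) := by
      intro h h0
      refine (seminorm_succ_le k n _).trans ?_
      have h0' : (h : ℂ) ≠ 0 := by exact_mod_cast h0
      have e : derivCLM ℂ ℂ ((h : ℂ)⁻¹ • (chirpCLM h φ - φ) - Complex.I • coordCLM (coordCLM φ))
          = ((h : ℂ)⁻¹ • (chirpCLM h (derivCLM ℂ ℂ φ) - derivCLM ℂ ℂ φ)
            - Complex.I • coordCLM (coordCLM (derivCLM ℂ ℂ φ)))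
            + (2 * Complex.I) • (chirpCLM h (coordCLM φ) - coordCLM φ) := by
        simp only [map_sub, map_smul, derivCLM_chirpCLM, derivCLM_coordCLM, map_add]
        ext p
        simp only [_root_.sub_apply, _root_.smul_apply, _root_.add_apply,
          smul_eq_mul]
        field_simp
        ring
      rw [e]
      refine (map_add_le_add _ _ _).trans (add_le_add le_rfl ?_)
      rw [map_smul_eq_mul]
      have : ‖2 * Complex.I‖ = 2 := by simp
      rw [this]
    refine squeeze_zero' (Eventually.of_forall fun h => apply_nonneg _ _)
      (eventually_mem_nhdsWithin.mono fun h hh => hb h hh) ?_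
    have h1 := (ih (derivCLM ℂ ℂ φ)).add
      (((tendsto_seminorm_chirpCLM_sub k n (coordCLM φ)).mono_left
        (nhdsWithin_le_nhds (s := {0}ᶜ))).const_mul 2)
    simpa using h1

theorem tendsto_chirpCLM_sub (φ : 𝓢(ℝ, ℂ)) :
    Tendsto (fun h : ℝ => chirpCLM h φ - φ) (𝓝 0) (𝓝 0) := by
  rw [(schwartz_withSeminorms ℂ ℝ ℂ).tendsto_nhds]
  rintro ⟨k, n⟩ ε hε
  simpa using (tendsto_seminorm_chirpCLM_sub k n φ).eventually_lt_const hε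

theorem tendsto_chirpCLM_slope (φ : 𝓢(ℝ, ℂ)) :
    Tendsto (fun h : ℝ => (h : ℂ)⁻¹ • (chirpCLM h φ - φ) - Complex.I • coordCLM (coordCLM φ))
      (𝓝[≠] 0) (𝓝 0) := by
  rw [(schwartz_withSeminorms ℂ ℝ ℂ).tendsto_nhds]
  rintro ⟨k, n⟩ ε hε
  simpa using (tendsto_seminorm_chirpCLM_slope k n φ).eventually_lt_const hε

end Multipliers

/-! ### Uniqueness of the solution, on the Fourier side. -/

section Uniqueness

theorem angularFourierCLM_eq_fourier (φ : 𝓢(ℝ, ℂ)) (p : ℝ) :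
    angularFourierCLM φ p
      = (FourierTransform.fourier (φ : ℝ → ℂ)) (p * (2 * Real.pi)⁻¹) := by
  rw [← SchwartzMap.fourier_coe]
  rfl

theorem derivCLM_angularFourierCLM (φ : 𝓢(ℝ, ℂ)) :
    derivCLM ℂ ℂ (angularFourierCLM φ) = -(Complex.I • angularFourierCLM (coordCLM φ)) := by
  ext p
  have hx : (fun x : ℝ => x • φ x) = coordCLM φ := by
    funext x
    rw [coordCLM_apply, Complex.real_smul]
  have hi : Integrable (fun x : ℝ => x • φ x) := by
    rw [hx]
    exact (coordCLM φ).integrable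
  have h1 := Real.deriv_fourier φ.integrable hi
  have hfun : (⇑(angularFourierCLM φ) : ℝ → ℂ)
      = fun p => (FourierTransform.fourier (φ : ℝ → ℂ)) ((2 * Real.pi)⁻¹ * p) :=
    funext fun p => by rw [angularFourierCLM_eq_fourier, mul_comm]
  rw [SchwartzMap.derivCLM_apply, hfun, deriv_comp_mul_left, h1, mul_comm _ p, _root_.neg_apply,
    _root_.smul_apply, angularFourierCLM_eq_fourier]
  have h2 : (fun x : ℝ => (-2 * (Real.pi : ℂ) * Complex.I * x) • φ x)
      = (-2 * (Real.pi : ℂ) * Complex.I) • (⇑(coordCLM φ) : ℝ → ℂ) := by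
    funext x
    simp only [Pi.smul_apply, coordCLM_apply, smul_eq_mul]
    ring
  rw [h2, Real.fourier_eq, Real.fourier_eq]
  have hpi : (Real.pi : ℂ) ≠ 0 := by exact_mod_cast Real.pi_ne_zero
  simp only [Pi.smul_apply, smul_comm _ (-2 * (Real.pi : ℂ) * Complex.I), integral_smul]
  rw [Complex.real_smul, smul_eq_mul, smul_eq_mul]
  push_cast
  field_simp

/-- Distributions may therefore be compared on test functions of the form `angularFourierCLM ψ`, and
the formula for `ψ` is the one that Fubini produces in `integral_mul_bandInvFourier`. -/
theorem exists_angularFourierCLM_eq (φ : 𝓢(ℝ, ℂ)) :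
    ∃ ψ : 𝓢(ℝ, ℂ), angularFourierCLM ψ = φ ∧
      ∀ p : ℝ, ψ p = (2 * Real.pi : ℂ)⁻¹ * ∫ x : ℝ, φ x * Complex.exp (Complex.I * x * p) := by
  set e : ℝ ≃L[ℝ] ℝ := ContinuousLinearEquiv.unitsEquivAut ℝ
    (Units.mk0 ((2 * Real.pi) : ℝ) Real.two_pi_pos.ne')
  have he : ∀ x, e x = x * (2 * Real.pi) := fun x => rfl
  set χ : 𝓢(ℝ, ℂ) := SchwartzMap.compCLMOfContinuousLinearEquiv ℂ e φ
  have hχ : ∀ x, χ x = φ (x * (2 * Real.pi)) := fun x => rfl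
  refine ⟨FourierTransformInv.fourierInv χ, ?_, fun p => ?_⟩
  · ext p
    rw [angularFourierCLM_eq_fourier, ← SchwartzMap.fourier_coe,
      FourierTransform.fourier_fourierInv_eq, hχ]
    congr 1
    field_simp
  · rw [SchwartzMap.fourierInv_coe, Real.fourierInv_eq']
    have h := Measure.integral_comp_mul_right
      (fun x : ℝ => φ x * Complex.exp (Complex.I * x * p)) (2 * Real.pi)
    rw [abs_of_pos (inv_pos.2 Real.two_pi_pos), Complex.real_smul] at h
    push_cast at h
    rw [← h]
    refine integral_congr_ae (Eventually.of_forall fun x => ?_)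
    simp only [smul_eq_mul, hχ]
    rw [mul_comm]
    congr 2
    simp
    ring

theorem exists_bound_of_continuousOn {u : ℝ → 𝓢'(ℝ, ℂ)} (hu : ContinuousOn u (Ici 0)) (T : ℝ)
    (φ : 𝓢(ℝ, ℂ)) : ∃ C, ∀ s ∈ Icc 0 T, ‖u s φ‖ ≤ C := by
  have : ContinuousOn (fun s => u s φ) (Icc 0 T) := by
    have h : ContinuousOn u (Icc 0 T) := hu.mono Icc_subset_Ici_self
    exact (PointwiseConvergenceCLM.evalCLM (RingHom.id ℂ) ℂ φ).continuous.comp_continuousOn h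
  exact isCompact_Icc.exists_bound_of_continuousOn this

/-- Weak-* continuity makes the family pointwise bounded on a compact time interval, so
Banach–Steinhaus applies there. The projection onto that interval is eventually the identity along
`l`. -/
theorem tendsto_solution_apply_zero {u : ℝ → 𝓢'(ℝ, ℂ)} (hu : ContinuousOn u (Ici 0)) {s₀ : ℝ}
    {l : Filter ℝ} (hl : l ≤ 𝓝[Ici 0] s₀) {χ : ℝ → 𝓢(ℝ, ℂ)} (hχ : Tendsto χ l (𝓝 0)) :
    Tendsto (fun s => u s (χ s)) l (𝓝 0) := by
  set i : ℝ → Icc 0 (max 0 (s₀ + 1)) := projIcc 0 (max 0 (s₀ + 1)) (le_max_left _ _)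
  have hb := tendsto_apply_zero_of_pointwise_bounded
    (v := fun s : Icc 0 (max 0 (s₀ + 1)) => (u s : 𝓢(ℝ, ℂ) →L[ℂ] ℂ)) (fun φ => by
      obtain ⟨C, hC⟩ := exists_bound_of_continuousOn hu (max 0 (s₀ + 1)) φ
      exact ⟨C, fun s => hC s s.2⟩) (i := i) hχ
  refine hb.congr' ?_
  have h1 : ∀ᶠ s in l, s ∈ Ici (0 : ℝ) := hl self_mem_nhdsWithin
  have h2 : ∀ᶠ s in l, s < s₀ + 1 :=
    hl (mem_nhdsWithin_of_mem_nhds (Iio_mem_nhds (lt_add_one s₀)))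
  filter_upwards [h1, h2] with s hs hs'
  have : (i s : ℝ) = s := by
    rw [show i s = ⟨s, hs, hs'.le.trans (le_max_right _ _)⟩ from projIcc_of_mem _ _]
  change u (i s) (χ s) = _
  rw [this]

theorem continuousOn_apply {u : ℝ → 𝓢'(ℝ, ℂ)} (hu : ContinuousOn u (Ici 0)) (φ : 𝓢(ℝ, ℂ)) :
    ContinuousOn (fun s => u s φ) (Ici 0) :=
  (PointwiseConvergenceCLM.evalCLM (RingHom.id ℂ) ℂ φ).continuous.comp_continuousOn hu

theorem hasDerivAt_angularFourier {u₀ : 𝓢'(ℝ, ℂ)} {u : ℝ → 𝓢'(ℝ, ℂ)} (hu : IsSolution u₀ u)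
    {t : ℝ} (ht : 0 < t) (ψ : 𝓢(ℝ, ℂ)) :
    HasDerivAt (fun s : ℝ => angularFourier (u s) ψ)
      (-(Complex.I * angularFourier (u t) (coordCLM (coordCLM ψ)))) t := by
  have h := hu.equation t ht (angularFourierCLM ψ)
  refine h.congr_deriv ?_
  rw [TemperedDistribution.derivCLM_apply_apply, TemperedDistribution.derivCLM_apply_apply]
  have e : -(derivCLM ℂ ℂ) (-(derivCLM ℂ ℂ) (angularFourierCLM ψ))
      = -angularFourierCLM (coordCLM (coordCLM ψ)) := by
    rw [derivCLM_angularFourierCLM, neg_neg, map_smul, derivCLM_angularFourierCLM, smul_neg,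
      neg_neg, smul_smul, Complex.I_mul_I, neg_one_smul]
  rw [e, map_neg, mul_neg]
  rfl

/-- The product rule: the slope splits into the slope of `v` at the fixed `θ`, `v s` applied to a
slope error tending to `0`, and `v s` applied to the fixed function `ip²θ`. The limits of the first
and third terms cancel by the equation. -/
theorem hasDerivAt_angularFourier_chirpCLM {u₀ : 𝓢'(ℝ, ℂ)} {u : ℝ → 𝓢'(ℝ, ℂ)}
    (hu : IsSolution u₀ u) {t : ℝ} (ht : 0 < t) (ψ : 𝓢(ℝ, ℂ)) :
    HasDerivAt (fun s : ℝ => angularFourier (u s) (chirpCLM s ψ)) 0 t := by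
  set v : ℝ → 𝓢'(ℝ, ℂ) := fun s => angularFourier (u s) with hv
  have hvc : ContinuousOn v (Ici 0) :=
    (PointwiseConvergenceCLM.precomp ℂ angularFourierCLM).continuous.comp_continuousOn hu.continuousOn
  -- Rebasing at time `t` by the group law, so that only the slope of the multiplier at `0` is
  -- needed.
  set θ := chirpCLM t ψ
  have h1 := hasDerivAt_angularFourier hu ht θ
  rw [hasDerivAt_iff_tendsto_slope] at h1 ⊢
  have hle : 𝓝[≠] t ≤ 𝓝[Ici 0] t := by
    rw [nhdsWithin_eq_nhds.2 (Ici_mem_nhds ht)]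
    exact nhdsWithin_le_nhds
  have hshift : Tendsto (fun s : ℝ => s - t) (𝓝[≠] t) (𝓝[≠] 0) := by
    refine tendsto_nhdsWithin_iff.2 ⟨?_, ?_⟩
    · have : Tendsto (fun s : ℝ => s - t) (𝓝 t) (𝓝 (t - t)) := (continuous_sub_right t).tendsto t
      rw [sub_self] at this
      exact this.mono_left nhdsWithin_le_nhds
    · filter_upwards [self_mem_nhdsWithin] with s hs
      exact sub_ne_zero.2 hs
  have h2 := tendsto_solution_apply_zero hvc hle ((tendsto_chirpCLM_slope θ).comp hshift)
  have h3 : Tendsto (fun s => v s (Complex.I • coordCLM (coordCLM θ))) (𝓝[≠] t)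
      (𝓝 (v t (Complex.I • coordCLM (coordCLM θ)))) :=
    ((continuousOn_apply hvc _).continuousWithinAt (mem_Ici.2 ht.le)).tendsto.mono_left hle
  have h4 := (h1.add h2).add h3
  have h5 : -(Complex.I * angularFourier (u t) (coordCLM (coordCLM θ))) + 0
      + v t (Complex.I • coordCLM (coordCLM θ)) = 0 := by
    rw [map_smul, smul_eq_mul, hv]
    ring
  rw [h5] at h4
  refine h4.congr' ?_
  filter_upwards [self_mem_nhdsWithin] with s hs
  have e : chirpCLM s ψ = chirpCLM (s - t) θ := by
    rw [← chirpCLM_add, add_sub_cancel]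
  simp only [slope_def_module, Function.comp_apply]
  rw [e, map_sub, map_smul, map_sub]
  have e2 : ∀ z : ℂ, (s - t)⁻¹ • z = ((s - t : ℝ) : ℂ)⁻¹ * z := fun z => by
    rw [Complex.real_smul, Complex.ofReal_inv]
  rw [e2, e2, smul_eq_mul]
  ring

/-- Uniqueness for the Schrödinger equation, on the Fourier side. -/
theorem angularFourier_solution_apply {u₀ : 𝓢'(ℝ, ℂ)} {u : ℝ → 𝓢'(ℝ, ℂ)} (hu : IsSolution u₀ u)
    {t : ℝ} (ht : 0 < t) (ψ : 𝓢(ℝ, ℂ)) :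
    angularFourier (u t) ψ = angularFourier u₀ (chirpCLM (-t) ψ) := by
  set θ := chirpCLM (-t) ψ
  have hθ : chirpCLM t θ = ψ := by
    rw [← chirpCLM_add, neg_add_cancel, chirpCLM_zero]
  set v : ℝ → 𝓢'(ℝ, ℂ) := fun s => angularFourier (u s) with hv
  have hvc : ContinuousOn v (Ici 0) :=
    (PointwiseConvergenceCLM.precomp ℂ angularFourierCLM).continuous.comp_continuousOn hu.continuousOn
  have hcont : ContinuousOn (fun s => v s (chirpCLM s θ)) (Icc 0 t) := by
    intro s hs
    -- The equation is available only for positive times, so continuity at `0` comes from that of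
    -- `u` and Banach–Steinhaus.
    rcases hs.1.eq_or_lt with rfl | hpos
    · have h1 := tendsto_solution_apply_zero hvc (nhdsWithin_mono (0 : ℝ) Icc_subset_Ici_self)
        ((tendsto_chirpCLM_sub θ).mono_left (nhdsWithin_le_nhds (s := Icc 0 t)))
      have h2 : Tendsto (fun s => v s θ) (𝓝[Icc 0 t] 0) (𝓝 (v 0 θ)) :=
        ((continuousOn_apply hvc θ).continuousWithinAt self_mem_Ici).tendsto.mono_left
          (nhdsWithin_mono _ Icc_subset_Ici_self)
      have h3 := h1.add h2
      rw [zero_add] at h3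
      unfold ContinuousWithinAt
      beta_reduce
      rw [chirpCLM_zero]
      refine h3.congr fun s => ?_
      rw [map_sub, sub_add_cancel]
    · exact (hasDerivAt_angularFourier_chirpCLM hu hpos θ).continuousAt.continuousWithinAt
  have := intervalIntegral.integral_eq_sub_of_hasDerivAt_of_le ht.le hcont
    (fun s hs => hasDerivAt_angularFourier_chirpCLM hu hs.1 θ) intervalIntegrable_const
  rw [intervalIntegral.integral_zero, eq_comm, sub_eq_zero] at this
  simp only [hv, hθ, chirpCLM_zero, hu.initial] at this
  exact this

end Uniqueness

/-! ### The upper bound for the oscillatory integral. -/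

section VanDerCorput

variable {p₁ p₂ μ : ℝ} {ut : ℝ → ℂ} {M : ℝ}

theorem hasDerivAt_chirp_sub (s p₀ p : ℝ) :
    HasDerivAt (fun p => chirp s (p - p₀))
      (2 * Complex.I * s * ((p - p₀ : ℝ) : ℂ) * chirp s (p - p₀)) p :=
  (hasDerivAt_chirp s (p - p₀)).comp_sub_const p p₀

theorem hasDerivAt_rpow_sub {p : ℝ} (r : ℝ) (hp : p₁ < p) :
    HasDerivAt (fun p => (p - p₁) ^ r) (r * (p - p₁) ^ (r - 1)) p := by
  have := (Real.hasDerivAt_rpow_const (x := p - p₁) (p := r)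
    (Or.inl (sub_pos.2 hp).ne')).comp_sub_const p p₁
  exact this

/-- Away from `p₀` the exponential is its own derivative divided by `-2it(p-p₀)`. Each boundary term
is at most `M δ^(μ-1) δ⁻¹`. In the remainder both `(p-p₁)^(μ-1)` and `(p-p₀)⁻¹` are monotone, so
their variations are at most `δ^(μ-1)` and `δ⁻¹`; this contributes `2M + N`, and `4M + N` in total.
-/
theorem norm_integral_Ioc_le_of_integration_by_parts (hμ₁ : μ ≤ 1)
    (hc : ContinuousOn ut (Icc p₁ p₂)) (hd : DifferentiableOn ℝ ut (Ioo p₁ p₂))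
    (hi : IntegrableOn (deriv ut) (Ioo p₁ p₂)) (hM : ∀ p ∈ Icc p₁ p₂, ‖ut p‖ ≤ M)
    (hM₀ : 0 ≤ M)
    {t δ p₀ α β : ℝ} (ht : 0 < t) (hδ : 0 < δ) (hα : p₁ + δ ≤ α) (hβ : β ≤ p₂)
    (hp₀ : p₀ + δ ≤ α ∨ β ≤ p₀ - δ) :
    ‖∫ p in Ioc α β, (((p - p₁) ^ (μ - 1) : ℝ) : ℂ) * ut p * chirp (-t) (p - p₀)‖
      ≤ (4 * M + derivNorm p₁ p₂ ut) * (δ ^ (μ - 1) * δ⁻¹) / (2 * t) := by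
  have hN : 0 ≤ derivNorm p₁ p₂ ut := integral_nonneg fun _ => norm_nonneg _
  have hG : 0 ≤ δ ^ (μ - 1) := Real.rpow_nonneg hδ.le _
  rcases lt_or_ge β α with hlt | hle
  · rw [Ioc_eq_empty hlt.not_gt, setIntegral_empty, norm_zero]
    positivity
  set G := δ ^ (μ - 1) with hGdef
  set g : ℝ → ℝ := fun p => (p - p₁) ^ (μ - 1) with hg
  set g' : ℝ → ℝ := fun p => (μ - 1) * (p - p₁) ^ (μ - 1 - 1) with hg'
  set k : ℝ → ℝ := fun p => (p - p₀)⁻¹ with hk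
  set k' : ℝ → ℝ := fun p => -((p - p₀) ^ 2)⁻¹ with hk'
  set e : ℝ → ℂ := fun p => chirp (-t) (p - p₀) with he
  have hne : ∀ p ∈ Icc α β, p - p₀ ≠ 0 ∧ δ ≤ |p - p₀| := by
    rintro p ⟨h1, h2⟩
    have : δ ≤ |p - p₀| := by
      rcases hp₀ with h | h
      · exact le_trans (by linarith) (le_abs_self _)
      · exact le_trans (by linarith) (neg_le_abs _)
    exact ⟨abs_pos.1 (hδ.trans_le this), this⟩
  have hgt : ∀ p ∈ Icc α β, p₁ < p := fun p hp => by linarith [hp.1]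
  have hIcc : Icc α β ⊆ Icc p₁ p₂ := Icc_subset_Icc (by linarith) hβ
  have hIoo : Ioo α β ⊆ Ioo p₁ p₂ := Ioo_subset_Ioo (by linarith) hβ
  have hgd : ∀ p ∈ Icc α β, HasDerivAt g (g' p) p := fun p hp =>
    hasDerivAt_rpow_sub _ (hgt p hp)
  have hkd : ∀ p ∈ Icc α β, HasDerivAt k (k' p) p := fun p hp => by
    have := ((hasDerivAt_id p).sub_const p₀).inv (hne p hp).1
    refine this.congr_deriv ?_
    simp [hk', neg_div]
  have hgc : ContinuousOn g (Icc α β) := fun p hp => (hgd p hp).continuousAt.continuousWithinAt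
  have hkc : ContinuousOn k (Icc α β) := fun p hp => (hkd p hp).continuousAt.continuousWithinAt
  have hg'c : ContinuousOn g' (Icc α β) := fun p hp =>
    ((hasDerivAt_rpow_sub _ (hgt p hp)).continuousAt.const_mul _).continuousWithinAt
  have hk'c : ContinuousOn k' (Icc α β) := by
    refine ((((continuousOn_id.sub continuousOn_const).pow 2)).inv₀ fun p hp => ?_).neg
    exact pow_ne_zero 2 (hne p hp).1
  have hec : Continuous e := (continuous_chirp _).comp (continuous_sub_right p₀)
  have huc := hc.mono hIcc
  have hudiff : ∀ p ∈ Ioo α β, HasDerivAt ut (deriv ut p) p := fun p hp =>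
    (hd.differentiableAt (isOpen_Ioo.mem_nhds (hIoo hp))).hasDerivAt
  have hudint : IntegrableOn (deriv ut) (Icc α β) := by
    rw [integrableOn_Icc_iff_integrableOn_Ioo]
    exact hi.mono_set hIoo
  -- pointwise bounds
  have hg0 : ∀ p ∈ Icc α β, 0 ≤ g p ∧ g p ≤ G := fun p hp =>
    ⟨Real.rpow_nonneg (sub_pos.2 (hgt p hp)).le _,
      Real.rpow_le_rpow_of_nonpos hδ (by linarith [hp.1]) (by linarith)⟩
  have hk0 : ∀ p ∈ Icc α β, |k p| ≤ δ⁻¹ := fun p hp => by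
    rw [hk, abs_inv]
    exact inv_anti₀ hδ (hne p hp).2
  have hg'0 : ∀ p ∈ Icc α β, g' p ≤ 0 := fun p hp =>
    mul_nonpos_of_nonpos_of_nonneg (by linarith) (Real.rpow_nonneg (sub_pos.2 (hgt p hp)).le _)
  have hk'0 : ∀ p, k' p ≤ 0 := fun p => neg_nonpos.2 (inv_nonneg.2 (sq_nonneg _))
  -- the derivative identity
  set R : ℝ → ℂ := fun p => ((g' p * k p + g p * k' p : ℝ) : ℂ) * ut p * e p
    + ((g p * k p : ℝ) : ℂ) * e p * deriv ut p with hR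
  set w : ℝ → ℂ := fun p => (g p : ℂ) * ut p * e p with hw
  have hFd : ∀ p ∈ Ioo α β, HasDerivAt (fun p => ((g p * k p : ℝ) : ℂ) * ut p * e p)
      (R p - (2 * Complex.I * t) * w p) p := by
    intro p hp
    have hp' := Ioo_subset_Icc_self hp
    have h1 := ((hgd p hp').mul (hkd p hp')).ofReal_comp
    have h2 := (h1.mul (hudiff p hp)).mul (hasDerivAt_chirp_sub (-t) p₀ p)
    refine h2.congr_deriv ?_
    have hkp : ((k p : ℝ) : ℂ) * ((p - p₀ : ℝ) : ℂ) = 1 := by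
      rw [← Complex.ofReal_mul, hk, inv_mul_cancel₀ (hne p hp').1, Complex.ofReal_one]
    simp only [hR, hw, Pi.mul_apply]
    push_cast at hkp ⊢
    linear_combination (-2 * Complex.I * t * (g p) * ut p * e p) * hkp
  have hRint : IntervalIntegrable R volume α β := by
    rw [intervalIntegrable_iff_integrableOn_Icc_of_le hle]
    refine IntegrableOn.add ?_ ?_
    · refine ContinuousOn.integrableOn_Icc ?_
      exact ((Complex.continuous_ofReal.comp_continuousOn
        ((hg'c.mul hkc).add (hgc.mul hk'c))).mul huc).mul hec.continuousOn
    · exact hudint.continuousOn_mul ((Complex.continuous_ofReal.comp_continuousOn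
        (hgc.mul hkc)).mul hec.continuousOn) isCompact_Icc
  have hwint : IntervalIntegrable w volume α β := by
    refine ContinuousOn.intervalIntegrable_of_Icc hle ?_
    exact ((Complex.continuous_ofReal.comp_continuousOn hgc).mul huc).mul hec.continuousOn
  have hFTC := intervalIntegral.integral_eq_sub_of_hasDerivAt_of_le
    (f := fun p => ((g p * k p : ℝ) : ℂ) * ut p * e p) hle
    (((Complex.continuous_ofReal.comp_continuousOn (hgc.mul hkc)).mul huc).mul hec.continuousOn)
    hFd (hRint.sub (hwint.const_mul _))
  rw [intervalIntegral.integral_sub hRint (hwint.const_mul _),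
    intervalIntegral.integral_const_mul] at hFTC
  -- bounds for the boundary terms
  have hFb : ∀ p ∈ Icc α β, ‖((g p * k p : ℝ) : ℂ) * ut p * e p‖ ≤ M * (G * δ⁻¹) := by
    intro p hp
    rw [norm_mul, norm_mul, he, norm_chirp, mul_one, Complex.norm_real, Real.norm_eq_abs, abs_mul,
      abs_of_nonneg (hg0 p hp).1, mul_comm]
    exact mul_le_mul (hM p (hIcc hp)) (mul_le_mul (hg0 p hp).2 (hk0 p hp) (abs_nonneg _) hG)
      (mul_nonneg (hg0 p hp).1 (abs_nonneg _)) hM₀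
  -- bound for the remainder
  have hgint : ∫ p in α..β, -g' p ≤ G := by
    rw [intervalIntegral.integral_neg, intervalIntegral.integral_eq_sub_of_hasDerivAt_of_le hle hgc
      (fun p hp => hgd p (Ioo_subset_Icc_self hp)) (hg'c.intervalIntegrable_of_Icc hle)]
    have h1 := hg0 α ⟨le_rfl, hle⟩
    have h2 := hg0 β ⟨hle, le_rfl⟩
    linarith
  have hkint : ∫ p in α..β, -k' p ≤ δ⁻¹ := by
    rw [intervalIntegral.integral_neg, intervalIntegral.integral_eq_sub_of_hasDerivAt_of_le hle hkc
      (fun p hp => hkd p (Ioo_subset_Icc_self hp)) (hk'c.intervalIntegrable_of_Icc hle)]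
    have h1 := hk0 α ⟨le_rfl, hle⟩
    have h2 := hk0 β ⟨hle, le_rfl⟩
    -- `(p-p₀)⁻¹` keeps one sign on the interval, so the difference of its end values costs `δ⁻¹`
    -- and not `2δ⁻¹`.
    rcases hp₀ with h | h
    · have : 0 ≤ k β := inv_nonneg.2 (by linarith)
      linarith [le_abs_self (k α)]
    · have : k α ≤ 0 := inv_nonpos.2 (by linarith)
      linarith [neg_abs_le (k β)]
  have huint : ∫ p in α..β, ‖deriv ut p‖ ≤ derivNorm p₁ p₂ ut := by
    rw [intervalIntegral.integral_of_le hle, integral_Ioc_eq_integral_Ioo]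
    exact setIntegral_mono_set hi.norm (Eventually.of_forall fun _ => norm_nonneg _)
      hIoo.eventuallyLE
  have hB1 : IntervalIntegrable (fun p => M * δ⁻¹ * (-g' p)) volume α β :=
    (hg'c.intervalIntegrable_of_Icc hle).neg.const_mul _
  have hB2 : IntervalIntegrable (fun p => M * G * (-k' p)) volume α β :=
    (hk'c.intervalIntegrable_of_Icc hle).neg.const_mul _
  have hB3 : IntervalIntegrable (fun p => G * δ⁻¹ * ‖deriv ut p‖) volume α β :=
    (((intervalIntegrable_iff_integrableOn_Icc_of_le hle).2 hudint).norm).const_mul _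
  have hRb : ‖∫ p in α..β, R p‖
      ≤ ∫ p in α..β, (M * δ⁻¹ * (-g' p) + M * G * (-k' p) + G * δ⁻¹ * ‖deriv ut p‖) := by
    refine intervalIntegral.norm_integral_le_of_norm_le hle (Eventually.of_forall fun p hp => ?_)
      ((hB1.add hB2).add hB3)
    have hp' := Ioc_subset_Icc_self hp
    obtain ⟨hga, hgb⟩ := hg0 p hp'
    have hka := hk0 p hp'
    have hMp := hM p (hIcc hp')
    refine (norm_add_le _ _).trans (add_le_add ?_ ?_)
    · rw [norm_mul, norm_mul, he, norm_chirp, mul_one, Complex.norm_real, Real.norm_eq_abs]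
      have h1 : |g' p * k p + g p * k' p| ≤ -g' p * δ⁻¹ + G * -k' p := by
        refine (abs_add_le _ _).trans (add_le_add ?_ ?_)
        · rw [abs_mul, abs_of_nonpos (hg'0 p hp')]
          exact mul_le_mul_of_nonneg_left hka (neg_nonneg.2 (hg'0 p hp'))
        · rw [abs_mul, abs_of_nonneg hga, abs_of_nonpos (hk'0 p)]
          exact mul_le_mul_of_nonneg_right hgb (neg_nonneg.2 (hk'0 p))
      calc _ ≤ (-g' p * δ⁻¹ + G * -k' p) * M :=
            mul_le_mul h1 hMp (norm_nonneg _) ((abs_nonneg _).trans h1)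
        _ = _ := by ring
    · rw [norm_mul, norm_mul, he, norm_chirp, mul_one, Complex.norm_real, Real.norm_eq_abs, abs_mul,
        abs_of_nonneg hga]
      gcongr
  rw [intervalIntegral.integral_add (hB1.add hB2) hB3, intervalIntegral.integral_add hB1 hB2,
    intervalIntegral.integral_const_mul, intervalIntegral.integral_const_mul,
    intervalIntegral.integral_const_mul] at hRb
  have hRb2 : ‖∫ p in α..β, R p‖ ≤ (2 * M + derivNorm p₁ p₂ ut) * (G * δ⁻¹) := by
    have hδ' : 0 ≤ δ⁻¹ := (inv_pos.2 hδ).le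
    have h1 := mul_le_mul_of_nonneg_left hgint (mul_nonneg hM₀ hδ')
    have h2 := mul_le_mul_of_nonneg_left hkint (mul_nonneg hM₀ hG)
    have h3 := mul_le_mul_of_nonneg_left huint (mul_nonneg hG hδ')
    linarith
  have hfin : ‖(2 * Complex.I * t) * ∫ p in α..β, w p‖
      ≤ (4 * M + derivNorm p₁ p₂ ut) * (G * δ⁻¹) := by
    have e1 : (2 * Complex.I * t) * ∫ p in α..β, w p = (∫ p in α..β, R p)
        - (((g β * k β : ℝ) : ℂ) * ut β * e β - ((g α * k α : ℝ) : ℂ) * ut α * e α) := by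
      rw [← hFTC]
      ring
    rw [e1]
    have h1 := hFb α ⟨le_rfl, hle⟩
    have h2 := hFb β ⟨hle, le_rfl⟩
    refine (norm_sub_le _ _).trans ?_
    have h3 := norm_sub_le (((g β * k β : ℝ) : ℂ) * ut β * e β) (((g α * k α : ℝ) : ℂ) * ut α * e α)
    linarith
  rw [norm_mul] at hfin
  have h2t : ‖2 * Complex.I * (t : ℂ)‖ = 2 * t := by simp [abs_of_pos ht]
  rw [h2t] at hfin
  rw [← intervalIntegral.integral_of_le hle, le_div_iff₀ (by positivity), mul_comm]
  exact hfin

theorem integrableOn_rpow_sub (hμ₀ : 0 < μ) (b : ℝ) :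
    IntegrableOn (fun p => (p - p₁) ^ (μ - 1)) (Ioc p₁ b) := by
  rcases le_or_gt p₁ b with h | h
  · have h1 := intervalIntegral.intervalIntegrable_rpow' (a := 0) (b := b - p₁) (r := μ - 1)
      (by linarith)
    have h2 := h1.comp_sub_right p₁
    rw [zero_add, sub_add_cancel, intervalIntegrable_iff_integrableOn_Ioc_of_le h] at h2
    exact h2
  · rw [Ioc_eq_empty h.not_gt]
    exact integrableOn_empty

theorem integral_rpow_sub (hμ₀ : 0 < μ) {δ : ℝ} (hδ : 0 ≤ δ) :
    ∫ p in Ioc p₁ (p₁ + δ), (p - p₁) ^ (μ - 1) = δ ^ μ / μ := by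
  rw [← intervalIntegral.integral_of_le (by linarith),
    intervalIntegral.integral_comp_sub_right (fun p => p ^ (μ - 1)), sub_self, add_sub_cancel_left,
    integral_rpow (Or.inl (by linarith)), sub_add_cancel, Real.zero_rpow hμ₀.ne', sub_zero]

theorem integrableOn_amplitude (hμ₀ : 0 < μ)
    (hc : ContinuousOn ut (Icc p₁ p₂)) (hM : ∀ p ∈ Icc p₁ p₂, ‖ut p‖ ≤ M) :
    IntegrableOn (fun p => (((p - p₁) ^ (μ - 1) : ℝ) : ℂ) * ut p) (Ioc p₁ p₂) := by
  refine Integrable.mul_bdd (c := M) (integrableOn_rpow_sub hμ₀ p₂).ofReal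
    ((hc.mono Ioc_subset_Icc_self).aestronglyMeasurable measurableSet_Ioc) ?_
  filter_upwards [ae_restrict_mem measurableSet_Ioc] with p hp using hM p (Ioc_subset_Icc_self hp)

/-- The uniform bound for the oscillatory integral with quadratic phase and singular amplitude. -/
theorem norm_oscillatory_integral_le (hμ₀ : 0 < μ) (hμ₁ : μ ≤ 1)
    (hc : ContinuousOn ut (Icc p₁ p₂)) (hd : DifferentiableOn ℝ ut (Ioo p₁ p₂))
    (hi : IntegrableOn (deriv ut) (Ioo p₁ p₂)) (hM : ∀ p ∈ Icc p₁ p₂, ‖ut p‖ ≤ M)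
    (hM₀ : 0 ≤ M) {t : ℝ} (ht : 0 < t) (p₀ : ℝ) :
    ‖∫ p in Ioc p₁ p₂, (((p - p₁) ^ (μ - 1) : ℝ) : ℂ) * ut p * chirp (-t) (p - p₀)‖
      ≤ (3 / μ * M + (4 * M + derivNorm p₁ p₂ ut)) * t ^ (-(μ / 2)) := by
  set N := derivNorm p₁ p₂ ut with hN
  -- This scale balances the size bound `δ^μ` against the bound `δ^(μ-1) δ⁻¹ / t` from integration
  -- by parts.
  set δ : ℝ := t ^ (-(1 / 2 : ℝ)) with hδdef
  have hδ : 0 < δ := Real.rpow_pos_of_pos ht _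
  set G := δ ^ (μ - 1) with hGdef
  have hG : 0 ≤ G := Real.rpow_nonneg hδ.le _
  have hδμ : δ ^ μ = t ^ (-(μ / 2)) := by
    rw [hδdef, ← Real.rpow_mul ht.le]
    congr 1
    ring
  have hGδ : G * δ = t ^ (-(μ / 2)) := by
    rw [← hδμ, hGdef, ← Real.rpow_add_one hδ.ne', sub_add_cancel]
  have hGδ' : G * δ⁻¹ / t = t ^ (-(μ / 2)) := by
    have hδ2 : δ * δ * t = 1 := by
      rw [hδdef, ← Real.rpow_add ht, ← Real.rpow_add_one ht.ne']
      norm_num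
    rw [← hGδ]
    field_simp
    linear_combination (-G) * hδ2
  set h : ℝ → ℂ := fun p => (((p - p₁) ^ (μ - 1) : ℝ) : ℂ) * ut p * chirp (-t) (p - p₀) with hh
  have hint : IntegrableOn h (Ioc p₁ p₂) := by
    refine Integrable.mul_bdd (c := 1) (integrableOn_amplitude hμ₀ hc hM)
      ((continuous_chirp _).comp (continuous_sub_right p₀)).aestronglyMeasurable ?_
    exact Eventually.of_forall fun p => (norm_chirp (-t) (p - p₀)).le
  have hnorm : ∀ p ∈ Ioc p₁ p₂, ‖h p‖ ≤ M * (p - p₁) ^ (μ - 1) := by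
    intro p hp
    have hp0 : 0 ≤ (p - p₁) ^ (μ - 1) := Real.rpow_nonneg (sub_pos.2 hp.1).le _
    rw [hh, norm_mul, norm_mul, norm_chirp, mul_one, Complex.norm_real, Real.norm_eq_abs,
      abs_of_nonneg hp0, mul_comm]
    exact mul_le_mul_of_nonneg_right (hM p (Ioc_subset_Icc_self hp)) hp0
  have hbp : ∀ α β : ℝ, p₁ + δ ≤ α → β ≤ p₂ → (p₀ + δ ≤ α ∨ β ≤ p₀ - δ) →
      ‖∫ p in Ioc α β, h p‖ ≤ (4 * M + N) * t ^ (-(μ / 2)) / 2 := by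
    intro α β hα hβ hp₀
    refine (norm_integral_Ioc_le_of_integration_by_parts hμ₁ hc hd hi hM hM₀ ht hδ hα hβ hp₀).trans
      (le_of_eq ?_)
    rw [← hGδ', ← hGdef]
    field_simp
    rw [mul_comm]
  -- the piece at the singularity
  have hA : ‖∫ p in Ioc p₁ p₂ ∩ Iic (p₁ + δ), h p‖ ≤ M / μ * t ^ (-(μ / 2)) := by
    have hsub : Ioc p₁ p₂ ∩ Iic (p₁ + δ) ⊆ Ioc p₁ (p₁ + δ) := fun p hp => ⟨hp.1.1, hp.2⟩
    have hgi := (integrableOn_rpow_sub (p₁ := p₁) hμ₀ (p₁ + δ)).const_mul M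
    calc ‖∫ p in Ioc p₁ p₂ ∩ Iic (p₁ + δ), h p‖
        ≤ ∫ p in Ioc p₁ p₂ ∩ Iic (p₁ + δ), M * (p - p₁) ^ (μ - 1) := by
          refine norm_integral_le_of_norm_le (hgi.mono_measure (Measure.restrict_mono hsub le_rfl)) ?_
          filter_upwards [ae_restrict_mem (measurableSet_Ioc.inter measurableSet_Iic)] with p hp
            using hnorm p hp.1
      _ ≤ ∫ p in Ioc p₁ (p₁ + δ), M * (p - p₁) ^ (μ - 1) := by
          refine setIntegral_mono_set hgi ?_ hsub.eventuallyLE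
          filter_upwards [ae_restrict_mem measurableSet_Ioc] with p hp
          exact mul_nonneg hM₀ (Real.rpow_nonneg (sub_pos.2 hp.1).le _)
      _ = M / μ * t ^ (-(μ / 2)) := by
          rw [integral_const_mul, integral_rpow_sub hμ₀ hδ.le, hδμ]
          ring
  -- the piece at the stationary point
  have hB : ‖∫ p in Ioc (max (p₁ + δ) (p₀ - δ)) (min p₂ (p₀ + δ)), h p‖
      ≤ 2 * M / μ * t ^ (-(μ / 2)) := by
    have hvol : volume.real (Ioc (max (p₁ + δ) (p₀ - δ)) (min p₂ (p₀ + δ))) ≤ 2 * δ := by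
      rw [Real.volume_real_Ioc]
      refine max_le ?_ (by positivity)
      have h1 := min_le_right p₂ (p₀ + δ)
      have h2 := le_max_right (p₁ + δ) (p₀ - δ)
      linarith
    have h1 : ‖∫ p in Ioc (max (p₁ + δ) (p₀ - δ)) (min p₂ (p₀ + δ)), h p‖
        ≤ M * G * volume.real (Ioc (max (p₁ + δ) (p₀ - δ)) (min p₂ (p₀ + δ))) := by
      refine norm_setIntegral_le_of_norm_le_const measure_Ioc_lt_top fun p hp => ?_
      have hp1 : p₁ + δ < p := (le_max_left _ _).trans_lt hp.1
      have hp2 : p ∈ Ioc p₁ p₂ := ⟨by linarith, hp.2.trans (min_le_left _ _)⟩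
      refine (hnorm p hp2).trans (mul_le_mul_of_nonneg_left ?_ hM₀)
      exact Real.rpow_le_rpow_of_nonpos hδ (by linarith) (by linarith)
    calc _ ≤ M * G * (2 * δ) := h1.trans (by gcongr)
      _ = 2 * M * t ^ (-(μ / 2)) := by rw [← hGδ]; ring
      -- Weakened by `μ ≤ 1`, so that it adds to the `M / μ` of the singular piece to give `3 / μ *
      -- M`.
      _ ≤ 2 * M / μ * t ^ (-(μ / 2)) := by
          gcongr
          exact (le_div_iff₀ hμ₀).2 (mul_le_of_le_one_right (by positivity) hμ₁)
  -- Four pieces: near `p₁`, then left of, near and right of `p₀`. Any of the last three may be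
  -- empty, according to the position of `p₀`.
  have hsplit : ∫ p in Ioc p₁ p₂, h p = (∫ p in Ioc p₁ p₂ ∩ Iic (p₁ + δ), h p)
      + ((∫ p in Ioc (p₁ + δ) (min p₂ (p₀ - δ)), h p)
        + ((∫ p in Ioc (max (p₁ + δ) (p₀ - δ)) (min p₂ (p₀ + δ)), h p)
          + ∫ p in Ioc (max (max (p₁ + δ) (p₀ - δ)) (p₀ + δ)) p₂, h p)) := by
    have hs1 : Ioc p₁ p₂ \ Iic (p₁ + δ) = Ioc (p₁ + δ) p₂ := by
      rw [Ioc_sdiff_Iic, max_eq_right (by linarith)]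
    have hi1 : IntegrableOn h (Ioc (p₁ + δ) p₂) := hint.mono_set (Ioc_subset_Ioc_left (by linarith))
    have hi2 : IntegrableOn h (Ioc (max (p₁ + δ) (p₀ - δ)) p₂) :=
      hi1.mono_set (Ioc_subset_Ioc_left (le_max_left _ _))
    rw [← integral_inter_add_sdiff measurableSet_Iic hint, hs1,
      ← integral_inter_add_sdiff (s := Ioc (p₁ + δ) p₂) (t := Iic (p₀ - δ)) measurableSet_Iic hi1,
      Ioc_inter_Iic, Ioc_sdiff_Iic,
      ← integral_inter_add_sdiff (s := Ioc (max (p₁ + δ) (p₀ - δ)) p₂) (t := Iic (p₀ + δ))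
        measurableSet_Iic hi2, Ioc_inter_Iic, Ioc_inter_Iic, Ioc_sdiff_Iic]
  have hC := hbp (p₁ + δ) (min p₂ (p₀ - δ)) le_rfl (min_le_left _ _) (Or.inr (min_le_right _ _))
  have hD := hbp (max (max (p₁ + δ) (p₀ - δ)) (p₀ + δ)) p₂
    ((le_max_left _ _).trans (le_max_left _ _)) le_rfl (Or.inl (le_max_right _ _))
  rw [hsplit]
  refine (norm_add_le _ _).trans ?_
  refine (add_le_add hA ((norm_add_le _ _).trans
    (add_le_add hC ((norm_add_le _ _).trans (add_le_add hB hD))))).trans (le_of_eq ?_)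
  ring

end VanDerCorput

/-! ### Laplace's method for the Gaussian means of the amplitude. -/

section Laplace

theorem integrable_abs_rpow_mul_exp_neg_sq {r : ℝ} (hr : -1 < r) :
    Integrable (fun y : ℝ => |y| ^ r * Real.exp (-y ^ 2)) := by
  have h := (integrable_rpow_mul_exp_neg_mul_sq one_pos hr).integrableOn (s := Ioi 0)
  have h1 : IntegrableOn (fun y : ℝ => |y| ^ r * Real.exp (-y ^ 2)) (Ioi 0) := by
    refine h.congr_fun (fun y hy => ?_) measurableSet_Ioi
    simp only [abs_of_pos (mem_Ioi.1 hy), neg_mul, one_mul]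
  have h2 : IntegrableOn (fun y : ℝ => |y| ^ r * Real.exp (-y ^ 2)) (Iio 0) := by
    have h3 : IntegrableOn (fun y : ℝ => |y| ^ r * Real.exp (-y ^ 2)) (Ioi (-0)) := by
      rwa [neg_zero]
    simpa only [abs_neg, neg_sq] using h3.comp_neg_Iio
  rw [← integrableOn_univ, ← Iic_union_Ioi (a := (0 : ℝ)), integrableOn_union,
    integrableOn_Iic_iff_integrableOn_Iio]
  exact ⟨h2, h1⟩

theorem integral_abs_rpow_mul_exp_neg_sq_pos {r : ℝ} (hr : -1 < r) {E : Set ℝ}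
    (hE : Ioi 0 ⊆ E) : 0 < ∫ y in E, |y| ^ r * Real.exp (-y ^ 2) := by
  have hi := integrable_abs_rpow_mul_exp_neg_sq hr
  have hpos : 0 < ∫ y in Ioi (0 : ℝ), |y| ^ r * Real.exp (-y ^ 2) := by
    rw [setIntegral_pos_iff_support_of_nonneg_ae (Eventually.of_forall fun y => by positivity)
      hi.integrableOn]
    refine lt_of_lt_of_le ?_ (measure_mono (show Ioi (0 : ℝ) ⊆ _ from fun y hy => ⟨?_, hy⟩))
    · simp
    · rw [Function.mem_support]
      have : 0 < |y| := abs_pos.2 (mem_Ioi.1 hy).ne'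
      positivity
  exact hpos.trans_le (setIntegral_mono_set hi.integrableOn
    (Eventually.of_forall fun y => by positivity) hE.eventuallyLE)

/-- Substitution `s = y/√a`: the Jacobian and the homogeneity of `|s|^(μ-1)` together produce
`a^(-μ/2)`. -/
theorem integral_abs_rpow_mul_scale {μ a : ℝ} (ha : 0 < a) (w : ℝ → ℂ) :
    ((a ^ (μ / 2) : ℝ) : ℂ)
        * ∫ s : ℝ, ((|s| ^ (μ - 1) : ℝ) : ℂ) * w s * ((Real.exp (-a * s ^ 2) : ℝ) : ℂ)
      = ∫ y : ℝ, ((|y| ^ (μ - 1) * Real.exp (-y ^ 2) : ℝ) : ℂ) * w (y * (√a)⁻¹) := by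
  have hs : 0 < √a := Real.sqrt_pos.2 ha
  have h := Measure.integral_comp_inv_mul_right
    (fun s : ℝ => ((|s| ^ (μ - 1) : ℝ) : ℂ) * w s * ((Real.exp (-a * s ^ 2) : ℝ) : ℂ)) (√a)
  rw [abs_of_pos hs, Complex.real_smul] at h
  have hsplit : a ^ (μ / 2) = a ^ ((μ - 1) / 2) * √a := by
    rw [Real.sqrt_eq_rpow, ← Real.rpow_add ha]
    congr 1
    ring
  rw [hsplit, Complex.ofReal_mul, mul_assoc, ← h, ← integral_const_mul]
  refine integral_congr_ae (Eventually.of_forall fun y => ?_)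
  have h1 : |y * (√a)⁻¹| ^ (μ - 1) * a ^ ((μ - 1) / 2) = |y| ^ (μ - 1) := by
    rw [abs_mul, abs_of_pos (inv_pos.2 hs), Real.mul_rpow (abs_nonneg _) (inv_pos.2 hs).le,
      Real.inv_rpow hs.le, Real.sqrt_eq_rpow, ← Real.rpow_mul ha.le, mul_assoc, ← div_eq_inv_mul]
    rw [show 1 / 2 * (μ - 1) = (μ - 1) / 2 by ring, div_self (Real.rpow_pos_of_pos ha _).ne',
      mul_one]
  have h2 : -a * (y * (√a)⁻¹) ^ 2 = -y ^ 2 := by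
    rw [mul_pow, inv_pow, Real.sq_sqrt ha.le]
    field_simp
  simp only
  rw [h2, ← h1]
  push_cast
  ring

/-- Laplace's method at a point where the amplitude has a one- or two-sided limit. -/
theorem tendsto_laplace {μ M : ℝ} (hμ₀ : 0 < μ) {w : ℝ → ℂ} (hw : Measurable w)
    (hM : ∀ s, ‖w s‖ ≤ M) {E : Set ℝ} (hE : MeasurableSet E) (hE' : Ioi 0 ⊆ E) {c : ℂ} (hc : c ≠ 0)
    (hlim : ∀ y ≠ 0, Tendsto (fun a : ℝ => w (y * (√a)⁻¹)) atTop (𝓝 (E.indicator (fun _ => c) y))) :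
    ∃ L : ℂ, L ≠ 0 ∧ Tendsto (fun a : ℝ => ((a ^ (μ / 2) : ℝ) : ℂ)
        * ∫ s : ℝ, ((|s| ^ (μ - 1) : ℝ) : ℂ) * w s * ((Real.exp (-a * s ^ 2) : ℝ) : ℂ))
      atTop (𝓝 L) := by
  have hi := integrable_abs_rpow_mul_exp_neg_sq (r := μ - 1) (by linarith)
  refine ⟨∫ y : ℝ, ((|y| ^ (μ - 1) * Real.exp (-y ^ 2) : ℝ) : ℂ) * E.indicator (fun _ => c) y,
    ?_, ?_⟩
  · have h1 : ∀ y : ℝ, ((|y| ^ (μ - 1) * Real.exp (-y ^ 2) : ℝ) : ℂ) * E.indicator (fun _ => c) y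
        = E.indicator (fun y => ((|y| ^ (μ - 1) * Real.exp (-y ^ 2) : ℝ) : ℂ) * c) y := by
      intro y
      by_cases hy : y ∈ E <;> simp [hy]
    simp_rw [h1]
    rw [integral_indicator hE, integral_mul_const, integral_complex_ofReal]
    refine mul_ne_zero ?_ hc
    exact_mod_cast (integral_abs_rpow_mul_exp_neg_sq_pos (by linarith) hE').ne'
  · have h2 : Tendsto (fun a : ℝ =>
        ∫ y : ℝ, ((|y| ^ (μ - 1) * Real.exp (-y ^ 2) : ℝ) : ℂ) * w (y * (√a)⁻¹)) atTop
        (𝓝 (∫ y : ℝ, ((|y| ^ (μ - 1) * Real.exp (-y ^ 2) : ℝ) : ℂ)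
          * E.indicator (fun _ => c) y)) := by
      refine tendsto_integral_filter_of_dominated_convergence
        (fun y => |y| ^ (μ - 1) * Real.exp (-y ^ 2) * M) ?_ ?_ (hi.mul_const M) ?_
      · refine Eventually.of_forall fun a => ?_
        exact hi.ofReal.aestronglyMeasurable.mul
          (hw.comp (measurable_id.mul_const _)).aestronglyMeasurable
      · refine Eventually.of_forall fun a => Eventually.of_forall fun y => ?_
        rw [norm_mul, Complex.norm_real, Real.norm_of_nonneg (by positivity)]
        exact mul_le_mul_of_nonneg_left (hM _) (by positivity)
      · have : ∀ᵐ y : ℝ, y ≠ 0 := by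
          simp [ae_iff]
        filter_upwards [this] with y hy
        exact (hlim y hy).const_mul _
    refine h2.congr' ?_
    filter_upwards [eventually_gt_atTop 0] with a ha
    exact (integral_abs_rpow_mul_scale ha w).symm

theorem tendsto_mul_inv_sqrt_atTop (y : ℝ) :
    Tendsto (fun a : ℝ => y * (√a)⁻¹) atTop (𝓝 0) := by
  have := (tendsto_inv_atTop_zero.comp Real.tendsto_sqrt_atTop).const_mul y
  simpa using this

variable {p₁ p₂ μ : ℝ} {ut : ℝ → ℂ}

/-- The Gaussian means of the amplitude around a suitable point of the band, with a width adapted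
to the time, decay no faster than `t ^ (-μ / 2)`. -/
theorem exists_gaussian_mean_lower_bound (hp : p₁ < p₂) (hμ₀ : 0 < μ)
    (hc : ContinuousOn ut (Icc p₁ p₂)) {q : ℝ} (hut : ut q ≠ 0)
    (hq : q = p₁ ∨ (μ = 1 ∧ q ∈ Ioo p₁ p₂)) :
    ∃ l κ : ℝ, 0 < l ∧ 0 < κ ∧ ∀ t : ℝ, 1 ≤ t → κ * t ^ (-(μ / 2))
      ≤ ‖∫ p in Ioc p₁ p₂, (((p - p₁) ^ (μ - 1) : ℝ) : ℂ) * ut p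
          * ((Real.exp (-(l * t) * (p - q) ^ 2) : ℝ) : ℂ)‖ := by
  -- `v` extends `ut` continuously to the line, which provides measurability and the limit at `q`;
  -- `w` is its cutoff to the band, recentred at `q`.
  set v : ℝ → ℂ := IccExtend hp.le ((Icc p₁ p₂).domRestrict ut) with hv
  have hvc : Continuous v := (continuousOn_iff_continuous_domRestrict.1 hc).Icc_extend'
  have hvu : ∀ p ∈ Icc p₁ p₂, v p = ut p := fun p hp' => IccExtend_of_mem hp.le _ hp'
  obtain ⟨M, hM⟩ := isCompact_Icc.exists_bound_of_continuousOn hc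
  have hvM : ∀ p, ‖v p‖ ≤ M := fun p => hM _ (projIcc p₁ p₂ hp.le p).2
  set w : ℝ → ℂ := fun s => (Ioc p₁ p₂).indicator v (s + q) with hw
  have hwm : Measurable w :=
    (hvc.measurable.indicator measurableSet_Ioc).comp (measurable_id.add_const q)
  have hwM : ∀ s, ‖w s‖ ≤ M := fun s => (norm_indicator_le_norm_self _ _).trans (hvM _)
  have hqI : q ∈ Icc p₁ p₂ := by
    rcases hq with rfl | ⟨_, h⟩
    · exact ⟨le_rfl, hp.le⟩
    · exact Ioo_subset_Icc_self h
  have hqlt : q < p₂ := by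
    rcases hq with rfl | ⟨_, h⟩
    · exact hp
    · exact h.2
  have hshift : ∀ y : ℝ, Tendsto (fun a : ℝ => y * (√a)⁻¹ + q) atTop (𝓝 q) := fun y => by
    simpa using (tendsto_mul_inv_sqrt_atTop y).add_const q
  have hvlim : ∀ y : ℝ, Tendsto (fun a : ℝ => v (y * (√a)⁻¹ + q)) atTop (𝓝 (ut q)) := fun y => by
    rw [← hvu q hqI]
    exact (hvc.tendsto q).comp (hshift y)
  have hpt : ∀ a : ℝ, ∫ p in Ioc p₁ p₂, (((p - p₁) ^ (μ - 1) : ℝ) : ℂ) * ut p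
        * ((Real.exp (-a * (p - q) ^ 2) : ℝ) : ℂ)
      = ∫ s : ℝ, ((|s| ^ (μ - 1) : ℝ) : ℂ) * w s * ((Real.exp (-a * s ^ 2) : ℝ) : ℂ) := by
    intro a
    rw [← integral_indicator measurableSet_Ioc, ← integral_sub_right_eq_self
      (fun s : ℝ => ((|s| ^ (μ - 1) : ℝ) : ℂ) * w s * ((Real.exp (-a * s ^ 2) : ℝ) : ℂ)) q]
    refine integral_congr_ae (Eventually.of_forall fun p => ?_)
    simp only [hw, sub_add_cancel]
    by_cases h : p ∈ Ioc p₁ p₂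
    · have e : |p - q| ^ (μ - 1) = (p - p₁) ^ (μ - 1) := by
        rcases hq with rfl | ⟨rfl, _⟩
        · rw [abs_of_pos (sub_pos.2 h.1)]
        · simp
      rw [indicator_of_mem h, indicator_of_mem h, e, hvu p (Ioc_subset_Icc_self h)]
    · rw [indicator_of_notMem h, indicator_of_notMem h]
      simp
  -- After rescaling, the band fills a half-line when `q = p₁` and the whole line when `q` is
  -- interior.
  obtain ⟨E, hE, hE', hlim⟩ : ∃ E : Set ℝ, MeasurableSet E ∧ Ioi 0 ⊆ E ∧ ∀ y ≠ 0,
      Tendsto (fun a : ℝ => w (y * (√a)⁻¹)) atTop (𝓝 (E.indicator (fun _ => ut q) y)) := by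
    rcases hq with rfl | ⟨_, h⟩
    · refine ⟨Ioi 0, measurableSet_Ioi, subset_rfl, fun y hy => ?_⟩
      rcases hy.lt_or_gt with hy | hy
      · rw [indicator_of_notMem (by simpa using hy.le)]
        refine tendsto_const_nhds.congr' ?_
        filter_upwards with a
        rw [hw]
        refine (indicator_of_notMem (fun h => ?_) _).symm
        have : y * (√a)⁻¹ ≤ 0 := mul_nonpos_of_nonpos_of_nonneg hy.le (by positivity)
        linarith [h.1]
      · rw [indicator_of_mem (mem_Ioi.2 hy)]
        refine (hvlim y).congr' ?_
        filter_upwards [(hshift y).eventually_lt_const hp, eventually_gt_atTop 0] with a ha ha0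
        rw [hw]
        have : 0 < y * (√a)⁻¹ := mul_pos hy (inv_pos.2 (Real.sqrt_pos.2 ha0))
        exact (indicator_of_mem (show _ ∈ Ioc _ p₂ from ⟨by linarith, ha.le⟩) _).symm
    · refine ⟨univ, MeasurableSet.univ, subset_univ _, fun y _ => ?_⟩
      rw [indicator_of_mem (mem_univ y)]
      refine (hvlim y).congr' ?_
      filter_upwards [(hshift y).eventually_lt_const hqlt, (hshift y).eventually_const_lt h.1]
        with a ha ha'
      exact (indicator_of_mem (show _ ∈ Ioc p₁ p₂ from ⟨ha', ha.le⟩) _).symm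
  obtain ⟨L, hL, hten⟩ := tendsto_laplace hμ₀ hwm hwM hE hE' hut hlim
  have hev := hten.norm.eventually_const_lt (half_lt_self (norm_pos_iff.2 hL))
  -- Beyond `l` the rescaled mean exceeds `‖L‖ / 2`. With `a = l * t` this covers every `t ≥ 1`, not
  -- only large times.
  obtain ⟨l, hl⟩ := eventually_atTop.1 (hev.and (eventually_ge_atTop 1))
  have hl1 : 1 ≤ l := (hl l le_rfl).2
  have hl0 : 0 < l := one_pos.trans_le hl1
  refine ⟨l, l ^ (-(μ / 2)) * (‖L‖ / 2), hl0,
    mul_pos (Real.rpow_pos_of_pos hl0 _) (half_pos (norm_pos_iff.2 hL)), fun t ht => ?_⟩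
  have ht0 : 0 < t := one_pos.trans_le ht
  have h1 := (hl (l * t) (le_mul_of_one_le_right hl0.le ht)).1
  have hlt : 0 < (l * t) ^ (μ / 2) := Real.rpow_pos_of_pos (mul_pos hl0 ht0) _
  rw [hpt]
  rw [norm_mul, Complex.norm_real, Real.norm_of_nonneg hlt.le] at h1
  have h2 : l ^ (-(μ / 2)) * (‖L‖ / 2) * t ^ (-(μ / 2)) = (‖L‖ / 2) / (l * t) ^ (μ / 2) := by
    rw [div_eq_mul_inv (‖L‖ / 2), ← Real.rpow_neg (mul_pos hl0 ht0).le, Real.mul_rpow hl0.le ht0.le]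
    ring
  rw [h2, div_le_iff₀ hlt, mul_comm]
  exact h1.le

end Laplace

/-! ### Inverse Fourier transforms of functions on the band. -/

section Representation

/-- The inverse Fourier transform of a function on `(p₁, p₂]`. -/
def bandInvFourier (p₁ p₂ : ℝ) (V : ℝ → ℂ) (x : ℝ) : ℂ :=
  (2 * Real.pi : ℂ)⁻¹ * ∫ p in Ioc p₁ p₂, V p * Complex.exp (Complex.I * x * p)

theorem norm_cexp_I_mul_mul (x p : ℝ) : ‖Complex.exp (Complex.I * x * p)‖ = 1 := by
  rw [mul_assoc, ← Complex.ofReal_mul, mul_comm, Complex.norm_exp_ofReal_mul_I]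

variable {p₁ p₂ : ℝ} {V : ℝ → ℂ}

theorem norm_bandInvFourier_le (V : ℝ → ℂ) (x : ℝ) :
    ‖bandInvFourier p₁ p₂ V x‖ ≤ (2 * Real.pi)⁻¹ * ∫ p in Ioc p₁ p₂, ‖V p‖ := by
  have h2 : ‖(2 * Real.pi : ℂ)⁻¹‖ = (2 * Real.pi)⁻¹ := by
    simp [abs_of_pos Real.pi_pos]
  rw [bandInvFourier, norm_mul, h2]
  refine mul_le_mul_of_nonneg_left ((norm_integral_le_integral_norm _).trans (le_of_eq ?_))
    (by positivity)
  simp_rw [norm_mul, norm_cexp_I_mul_mul, mul_one]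

theorem continuous_bandInvFourier (hV : IntegrableOn V (Ioc p₁ p₂)) :
    Continuous (bandInvFourier p₁ p₂ V) := by
  refine continuous_const.mul (continuous_of_dominated (bound := fun p => ‖V p‖) (fun x => ?_)
    (fun x => Eventually.of_forall fun p => ?_) hV.norm (Eventually.of_forall fun p => ?_))
  · exact hV.aestronglyMeasurable.mul (by fun_prop : Continuous fun p : ℝ =>
      Complex.exp (Complex.I * x * p)).aestronglyMeasurable
  · rw [norm_mul, norm_cexp_I_mul_mul, mul_one]
  · fun_prop

theorem memLp_bandInvFourier (hV : IntegrableOn V (Ioc p₁ p₂)) :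
    MemLp (bandInvFourier p₁ p₂ V) ∞ (volume : Measure ℝ) :=
  memLp_top_of_bound (continuous_bandInvFourier hV).aestronglyMeasurable _
    (Eventually.of_forall fun x => norm_bandInvFourier_le V x)

theorem integral_mul_bandInvFourier (hV : IntegrableOn V (Ioc p₁ p₂)) {φ : ℝ → ℂ}
    (hφ : Integrable φ) :
    ∫ x : ℝ, φ x * bandInvFourier p₁ p₂ V x = ∫ p in Ioc p₁ p₂,
      V p * ((2 * Real.pi : ℂ)⁻¹ * ∫ x : ℝ, φ x * Complex.exp (Complex.I * x * p)) := by
  have hint : Integrable (Function.uncurry fun (x p : ℝ) =>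
      φ x * (V p * Complex.exp (Complex.I * x * p))) (volume.prod (volume.restrict (Ioc p₁ p₂))) := by
    have h1 : Integrable (fun z : ℝ × ℝ => φ z.1 * V z.2)
        (volume.prod (volume.restrict (Ioc p₁ p₂))) := hφ.mul_prod hV
    have h2 : Continuous fun z : ℝ × ℝ => Complex.exp (Complex.I * z.1 * z.2) := by fun_prop
    have h3 := h1.mul_bdd (c := 1) h2.aestronglyMeasurable
      (Eventually.of_forall fun z => (norm_cexp_I_mul_mul z.1 z.2).le)
    refine h3.congr (Eventually.of_forall fun z => ?_)
    simp only [Function.uncurry]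
    ring
  have hswap := integral_integral_swap hint
  simp_rw [integral_const_mul] at hswap
  have e1 : ∀ x, φ x * bandInvFourier p₁ p₂ V x = (2 * Real.pi : ℂ)⁻¹ *
      (φ x * ∫ p in Ioc p₁ p₂, V p * Complex.exp (Complex.I * x * p)) := fun x => by
    rw [bandInvFourier]
    ring
  simp_rw [e1]
  rw [integral_const_mul, hswap, ← integral_const_mul]
  refine integral_congr_ae (Eventually.of_forall fun p => ?_)
  simp only
  rw [mul_left_comm]
  congr 1
  rw [← integral_const_mul]
  congr 1
  funext x
  ring

/-- Testing against a modulated complex Gaussian bounds the Gaussian means of `V` by any essential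
bound of its inverse Fourier transform. -/
theorem norm_gaussian_mean_le (hV : IntegrableOn V (Ioc p₁ p₂)) {b : ℂ} (hb : 0 < b.re)
    (x₀ q : ℝ) {K : ℝ} (hK : ∀ᵐ x : ℝ, ‖bandInvFourier p₁ p₂ V x‖ ≤ K) :
    (2 * Real.pi)⁻¹ * √(b.re / ‖b‖) * ‖∫ p in Ioc p₁ p₂, V p *
        (Complex.exp (Complex.I * x₀ * p) * Complex.exp (-((p - q : ℝ) : ℂ) ^ 2 / (4 * b)))‖ ≤ K := by
  have hb0 : 0 < ‖b‖ := norm_pos_iff.2 fun h => by simp [h] at hb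
  -- The oscillating factor centres the transform of the Gaussian at `q`; the translation by `x₀`
  -- below modulates it.
  set γ : ℝ → ℂ := fun y => Complex.exp (-(Complex.I * y * q)) * Complex.exp (-b * (y : ℂ) ^ 2)
    with hγ
  have hγn : ∀ y, ‖γ y‖ = Real.exp (-b.re * y ^ 2) := by
    intro y
    have h1 : ‖Complex.exp (-(Complex.I * y * q))‖ = 1 := by
      rw [← Complex.norm_exp_ofReal_mul_I (-(y * q))]
      congr 2
      push_cast
      ring
    rw [hγ, norm_mul, h1, one_mul, Complex.norm_exp, ← Complex.ofReal_pow, Complex.re_mul_ofReal,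
      Complex.neg_re]
  have hγc : Continuous γ := by
    rw [hγ]
    fun_prop
  have hγi : Integrable γ := by
    refine (integrable_exp_neg_mul_sq hb).mono' hγc.aestronglyMeasurable
      (Eventually.of_forall fun y => (hγn y).le)
  have hφi : Integrable (fun x => γ (x - x₀)) := hγi.comp_sub_right x₀
  have hft : ∀ p : ℝ, ∫ x : ℝ, γ (x - x₀) * Complex.exp (Complex.I * x * p)
      = (Real.pi / b) ^ (1 / 2 : ℂ) * (Complex.exp (Complex.I * x₀ * p)
        * Complex.exp (-((p - q : ℝ) : ℂ) ^ 2 / (4 * b))) := by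
    intro p
    have h1 := integral_sub_right_eq_self (μ := volume)
      (fun y : ℝ => γ y * Complex.exp (Complex.I * (y + x₀ : ℝ) * p)) x₀
    simp only [sub_add_cancel] at h1
    rw [h1]
    have h2 := fourierIntegral_gaussian hb ((p - q : ℝ) : ℂ)
    have h3 : ∀ y : ℝ, γ y * Complex.exp (Complex.I * (y + x₀ : ℝ) * p)
        = Complex.exp (Complex.I * x₀ * p) * (Complex.exp (Complex.I * ((p - q : ℝ) : ℂ) * y)
          * Complex.exp (-b * (y : ℂ) ^ 2)) := by
      intro y
      simp only [hγ, ← Complex.exp_add]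
      congr 1
      push_cast
      ring
    simp_rw [h3]
    rw [integral_const_mul, h2]
    ring
  have hpair := integral_mul_bandInvFourier hV hφi
  simp_rw [hft] at hpair
  have hpair' : ∫ x : ℝ, γ (x - x₀) * bandInvFourier p₁ p₂ V x
      = ((2 * Real.pi : ℂ)⁻¹ * (Real.pi / b) ^ (1 / 2 : ℂ)) * ∫ p in Ioc p₁ p₂, V p *
        (Complex.exp (Complex.I * x₀ * p) * Complex.exp (-((p - q : ℝ) : ℂ) ^ 2 / (4 * b))) := by
    rw [hpair, ← integral_const_mul]
    congr 1
    funext p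
    ring
  have hle : ‖∫ x : ℝ, γ (x - x₀) * bandInvFourier p₁ p₂ V x‖ ≤ √(Real.pi / b.re) * K := by
    have h1 : ∫ x : ℝ, ‖γ (x - x₀)‖ * K = √(Real.pi / b.re) * K := by
      rw [integral_mul_const, integral_sub_right_eq_self (fun y => ‖γ y‖) x₀]
      simp_rw [hγn]
      rw [integral_gaussian]
    rw [← h1]
    refine norm_integral_le_of_norm_le (hφi.norm.mul_const K) ?_
    filter_upwards [hK] with x hx
    rw [norm_mul]
    exact mul_le_mul_of_nonneg_left hx (norm_nonneg _)
  -- Only the modulus of the root matters, and squaring removes the choice of branch.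
  have hroot : ‖((Real.pi : ℂ) / b) ^ (1 / 2 : ℂ)‖ = √(Real.pi / ‖b‖) := by
    rw [eq_comm, Real.sqrt_eq_iff_eq_sq (by positivity) (norm_nonneg _), ← norm_pow,
      ← Complex.cpow_nat_mul]
    simp [abs_of_pos Real.pi_pos]
  have h2 : ‖(2 * Real.pi : ℂ)⁻¹‖ = (2 * Real.pi)⁻¹ := by
    simp [abs_of_pos Real.pi_pos]
  rw [hpair', norm_mul, norm_mul, hroot, h2] at hle
  -- The second factor is the `L¹` norm of the Gaussian and cancels; the ratio left over is
  -- invariant under scaling of `b`.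
  have hs : √(Real.pi / ‖b‖) = √(b.re / ‖b‖) * √(Real.pi / b.re) := by
    rw [← Real.sqrt_mul (by positivity)]
    congr 1
    field_simp
  have hpos : 0 < √(Real.pi / b.re) := Real.sqrt_pos.2 (div_pos Real.pi_pos hb)
  rw [hs] at hle
  refine le_of_mul_le_mul_left ?_ hpos
  refine le_trans (le_of_eq ?_) hle
  ring

end Representation

/-! ### Bounds for the evolved wave packet. -/

section Band

variable {p₁ p₂ μ : ℝ} {ut : ℝ → ℂ}

/-- The Fourier transform of the solution at time `t`, as a function on the band. -/
def evolvedAmplitude (p₁ μ : ℝ) (ut : ℝ → ℂ) (t p : ℝ) : ℂ :=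
  (((p - p₁) ^ (μ - 1) : ℝ) : ℂ) * ut p * chirp (-t) p

theorem integrableOn_evolvedAmplitude (hμ₀ : 0 < μ) (hc : ContinuousOn ut (Icc p₁ p₂)) (t : ℝ) :
    IntegrableOn (evolvedAmplitude p₁ μ ut t) (Ioc p₁ p₂) := by
  obtain ⟨M, hM⟩ := isCompact_Icc.exists_bound_of_continuousOn hc
  exact (integrableOn_amplitude hμ₀ hc hM).mul_bdd (c := 1)
    (continuous_chirp _).aestronglyMeasurable
    (Eventually.of_forall fun p => (norm_chirp (-t) p).le)

theorem ae_norm_le_toReal_eLpNorm_top {f : ℝ → ℂ} {ν : Measure ℝ} (hf : MemLp f ∞ ν) :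
    ∀ᵐ x ∂ν, ‖f x‖ ≤ (eLpNorm f ∞ ν).toReal := by
  filter_upwards [ae_le_eLpNormEssSup (f := f) (μ := ν)] with x hx
  rw [← eLpNorm_exponent_top] at hx
  have := ENNReal.toReal_mono hf.eLpNorm_ne_top hx
  rwa [toReal_enorm] at this

/-- The essential bound holds on a set of full measure, which is dense in the band; continuity
carries it to every point, endpoints included. -/
theorem norm_le_supNorm (hp : p₁ < p₂) (hc : ContinuousOn ut (Icc p₁ p₂)) {p : ℝ}
    (hpI : p ∈ Icc p₁ p₂) : ‖ut p‖ ≤ supNorm p₁ p₂ ut := by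
  obtain ⟨C, hC⟩ := isCompact_Icc.exists_bound_of_continuousOn hc
  have hmem : MemLp ut ∞ (volume.restrict (Ioo p₁ p₂)) :=
    memLp_top_of_bound ((hc.mono Ioo_subset_Icc_self).aestronglyMeasurable measurableSet_Ioo) C
      ((ae_restrict_mem measurableSet_Ioo).mono fun p hp => hC p (Ioo_subset_Icc_self hp))
  have hae : ∀ᵐ p ∂volume.restrict (Ioo p₁ p₂), ‖ut p‖ ≤ supNorm p₁ p₂ ut:=
    ae_norm_le_toReal_eLpNorm_top hmem
  rw [ae_restrict_iff' measurableSet_Ioo] at hae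
  have hdense : Dense {p : ℝ | p ∈ Ioo p₁ p₂ → ‖ut p‖ ≤ supNorm p₁ p₂ ut} := Measure.dense_of_ae hae
  have hcl : Icc p₁ p₂ ⊆ closure (Ioo p₁ p₂ ∩ {p : ℝ | p ∈ Ioo p₁ p₂ → ‖ut p‖ ≤ supNorm p₁ p₂ ut}) := by
    rw [hdense.open_subset_closure_inter isOpen_Ioo |> fun h =>
      (closure_minimal h isClosed_closure).antisymm (closure_mono inter_subset_left) |>.symm,
      closure_Ioo hp.ne]
  have hmaps : MapsTo (fun p => ‖ut p‖)
      (Ioo p₁ p₂ ∩ {p : ℝ | p ∈ Ioo p₁ p₂ → ‖ut p‖ ≤ supNorm p₁ p₂ ut})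
      (Iic (supNorm p₁ p₂ ut)) := fun p hp => hp.2 hp.1
  have hsub : closure (Ioo p₁ p₂ ∩ {p : ℝ | p ∈ Ioo p₁ p₂ → ‖ut p‖ ≤ supNorm p₁ p₂ ut}) ⊆ Icc p₁ p₂ :=
    closure_minimal (inter_subset_left.trans Ioo_subset_Icc_self) isClosed_Icc
  have := hmaps.closure_of_continuousOn (hc.norm.mono hsub) (hcl hpI)
  rwa [isClosed_Iic.closure_eq] at this

/-- Completing the square, `xp - tp² = x²/(4t) - t(p - x/(2t))²`, and the first term contributes a
factor of modulus one. -/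
theorem norm_bandInvFourier_evolvedAmplitude_le (hp : p₁ < p₂) (hμ₀ : 0 < μ) (hμ₁ : μ ≤ 1)
    (hc : ContinuousOn ut (Icc p₁ p₂)) (hd : DifferentiableOn ℝ ut (Ioo p₁ p₂))
    (hi : IntegrableOn (deriv ut) (Ioo p₁ p₂)) {t : ℝ} (ht : 0 < t) (x : ℝ) :
    ‖bandInvFourier p₁ p₂ (evolvedAmplitude p₁ μ ut t) x‖
      ≤ constInside p₁ p₂ μ ut * t ^ (-(μ / 2)) := by
  have hphase : ∀ p : ℝ, evolvedAmplitude p₁ μ ut t p * Complex.exp (Complex.I * x * p)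
      = chirp t (x / (2 * t)) * ((((p - p₁) ^ (μ - 1) : ℝ) : ℂ) * ut p
        * chirp (-t) (p - x / (2 * t))) := by
    intro p
    have : chirp (-t) p * Complex.exp (Complex.I * x * p)
        = chirp t (x / (2 * t)) * chirp (-t) (p - x / (2 * t)) := by
      rw [chirp, chirp, chirp, ← Complex.exp_add, ← Complex.exp_add]
      congr 1
      have ht' : (t : ℂ) ≠ 0 := by exact_mod_cast ht.ne'
      push_cast
      field_simp
      ring
    rw [evolvedAmplitude, mul_assoc, this]
    ring
  have hM₀ : 0 ≤ supNorm p₁ p₂ ut := ENNReal.toReal_nonneg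
  have h := norm_oscillatory_integral_le hμ₀ hμ₁ hc hd hi (fun p hpI => norm_le_supNorm hp hc hpI)
    hM₀ ht (x / (2 * t))
  have h2 : ‖(2 * Real.pi : ℂ)⁻¹‖ = (2 * Real.pi)⁻¹ := by
    simp [abs_of_pos Real.pi_pos]
  rw [bandInvFourier, norm_mul, h2]
  simp_rw [hphase]
  rw [integral_const_mul, norm_mul, norm_chirp, one_mul]
  refine (mul_le_mul_of_nonneg_left h (by positivity)).trans (le_of_eq ?_)
  rw [constInside]
  field_simp

/-- Any essential bound of the wave at a time `t ≥ 1` is at least a multiple of `t ^ (-μ / 2)`. -/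
theorem exists_lower_bound (hp : p₁ < p₂) (hμ₀ : 0 < μ)
    (hc : ContinuousOn ut (Icc p₁ p₂)) {q : ℝ} (hut : ut q ≠ 0)
    (hq : q = p₁ ∨ (μ = 1 ∧ q ∈ Ioo p₁ p₂)) :
    ∃ c : ℝ, 0 < c ∧ ∀ t : ℝ, 1 ≤ t → ∀ K : ℝ,
      (∀ᵐ x : ℝ, ‖bandInvFourier p₁ p₂ (evolvedAmplitude p₁ μ ut t) x‖ ≤ K) →
        c * t ^ (-(μ / 2)) ≤ K := by
  obtain ⟨l, κ, hl, hκ, hmean⟩ := exists_gaussian_mean_lower_bound hp hμ₀ hc hut hq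
  -- With `B = b / t` below, `1 / (4B) = t(l - i)`: the real part is the Gaussian mean of width
  -- parameter `l * t`, the imaginary part cancels the quadratic phase.
  set b : ℂ := (4 * ((l : ℂ) - Complex.I))⁻¹ with hbdef
  have hlI : (l : ℂ) - Complex.I ≠ 0 := fun h => by
    have := congrArg Complex.re h
    simp at this
    exact hl.ne' this
  have hb : 0 < b.re := by
    rw [hbdef, Complex.inv_re]
    refine div_pos ?_ (Complex.normSq_pos.2 (mul_ne_zero (by norm_num) hlI))
    simpa using hl
  have hb0 : 0 < ‖b‖ := norm_pos_iff.2 fun h => by simp [h] at hb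
  refine ⟨(2 * Real.pi)⁻¹ * √(b.re / ‖b‖) * κ,
    mul_pos (mul_pos (by positivity) (Real.sqrt_pos.2 (div_pos hb hb0))) hκ, fun t ht K hK => ?_⟩
  have ht0 : 0 < t := one_pos.trans_le ht
  have htC : (t : ℂ) ≠ 0 := by exact_mod_cast ht0.ne'
  set B : ℂ := ((t⁻¹ : ℝ) : ℂ) * b with hB
  have hBre : B.re = t⁻¹ * b.re := Complex.re_ofReal_mul _ _
  have hBn : ‖B‖ = t⁻¹ * ‖b‖ := by
    rw [hB, norm_mul, Complex.norm_real, Real.norm_of_nonneg (by positivity)]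
  have hBpos : 0 < B.re := by
    rw [hBre]
    positivity
  have hratio : B.re / ‖B‖ = b.re / ‖b‖ := by
    rw [hBre, hBn, mul_div_mul_left _ _ (by positivity)]
  -- The centre `2tq` is the place reached at time `t` by frequency `q` at its group velocity; it
  -- cancels the phase that is linear in `p`.
  have h := norm_gaussian_mean_le (integrableOn_evolvedAmplitude hμ₀ hc t) hBpos (2 * t * q) q hK
  rw [hratio] at h
  refine le_trans ?_ h
  rw [mul_assoc]
  refine mul_le_mul_of_nonneg_left ((hmean t ht).trans (le_of_eq ?_)) (by positivity)
  have h4B : (4 * B)⁻¹ = t * (l - Complex.I) := by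
    rw [hB, hbdef]
    push_cast
    field_simp
  have hpt : ∀ p : ℝ, evolvedAmplitude p₁ μ ut t p *
      (Complex.exp (Complex.I * (2 * t * q : ℝ) * p)
        * Complex.exp (-((p - q : ℝ) : ℂ) ^ 2 / (4 * B)))
      = chirp t q * ((((p - p₁) ^ (μ - 1) : ℝ) : ℂ) * ut p
          * ((Real.exp (-(l * t) * (p - q) ^ 2) : ℝ) : ℂ)) := by
    intro p
    have : chirp (-t) p * (Complex.exp (Complex.I * (2 * t * q : ℝ) * p)
        * Complex.exp (-((p - q : ℝ) : ℂ) ^ 2 / (4 * B)))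
        = chirp t q * ((Real.exp (-(l * t) * (p - q) ^ 2) : ℝ) : ℂ) := by
      rw [div_eq_mul_inv, h4B, chirp, chirp, Complex.ofReal_exp, ← Complex.exp_add,
        ← Complex.exp_add, ← Complex.exp_add]
      congr 1
      push_cast
      ring
    rw [evolvedAmplitude, mul_assoc, this]
    ring
  simp_rw [hpt]
  rw [integral_const_mul, norm_mul, norm_chirp, one_mul]

end Band

/-! ### The solution as an element of `L^∞`, and the final bounds. -/

section Band

variable {p₁ p₂ μ : ℝ} {ut : ℝ → ℂ} {u₀ : 𝓢'(ℝ, ℂ)}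

theorem BandCondition.continuousOn (h : BandCondition p₁ p₂ μ u₀ ut) :
    ContinuousOn ut (Icc p₁ p₂) := by
  obtain ⟨_, hreg, _⟩ := h.exists_amplitude
  exact hreg.continuousOn

/-- Otherwise the transform of `u₀` would vanish, contradicting that its support contains `p₁`. -/
theorem BandCondition.exists_ne_zero (h : BandCondition p₁ p₂ μ u₀ ut) (hp : p₁ < p₂) :
    ∃ p ∈ Ioo p₁ p₂, ut p ≠ 0 := by
  by_contra! hzero
  obtain ⟨U, hreg, hU⟩ := h.exists_amplitude
  have hF : ∀ φ : 𝓢(ℝ, ℂ), angularFourier u₀ φ = 0 := fun φ => by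
    rw [hU, integral_Ioc_eq_integral_Ioo]
    refine setIntegral_eq_zero_of_forall_eq_zero fun p hpI => ?_
    rw [hreg.factor p (Ioo_subset_Ioc_self hpI), hzero p hpI, mul_zero, zero_mul]
  have hmem : p₁ ∈ Distribution.dsupport (angularFourier u₀) := by
    rw [h.support_eq]
    exact left_mem_Icc.2 hp.le
  obtain ⟨φ, _, hφ⟩ := (Distribution.mem_dsupport_iff_forall_exists_ne p₁).1 hmem univ
    (mem_univ _) isOpen_univ
  exact hφ (hF φ)

theorem BandCondition.supNorm_pos (h : BandCondition p₁ p₂ μ u₀ ut) (hp : p₁ < p₂) :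
    0 < supNorm p₁ p₂ ut := by
  obtain ⟨p, hpI, hne⟩ := h.exists_ne_zero hp
  exact (norm_pos_iff.2 hne).trans_le (norm_le_supNorm hp h.continuousOn (Ioo_subset_Icc_self hpI))

theorem derivNorm_nonneg (p₁ p₂ : ℝ) (ut : ℝ → ℂ) : 0 ≤ derivNorm p₁ p₂ ut :=
  integral_nonneg fun _ => norm_nonneg _

theorem constSide_pos (hμ₀ : 0 < μ) (hM : 0 < supNorm p₁ p₂ ut) {m : ℝ} (hm : 0 < m) :
    0 < constSide p₁ p₂ μ ut m := by
  have := derivNorm_nonneg p₁ p₂ ut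
  unfold constSide
  positivity

theorem constInside_pos (hμ₀ : 0 < μ) (hM : 0 < supNorm p₁ p₂ ut) :
    0 < constInside p₁ p₂ μ ut := by
  have := derivNorm_nonneg p₁ p₂ ut
  unfold constInside
  positivity

/-- The wave at time `t` as an essentially bounded function. -/
def wave (hμ₀ : 0 < μ) (hc : ContinuousOn ut (Icc p₁ p₂)) (t : ℝ) : Lp ℂ ∞ (volume : Measure ℝ) :=
  (memLp_bandInvFourier (integrableOn_evolvedAmplitude (p₂ := p₂) hμ₀ hc t)).toLp

/-- Uniqueness has fixed the transform of `u t`; Fubini and Fourier inversion of the test function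
identify it with that of the explicit wave. -/
theorem toTemperedDistribution_wave (hμ₀ : 0 < μ) (h : BandCondition p₁ p₂ μ u₀ ut)
    {u : ℝ → 𝓢'(ℝ, ℂ)} (hu : IsSolution u₀ u) {t : ℝ} (ht : 0 < t) :
    Lp.toTemperedDistribution (wave hμ₀ h.continuousOn t) = u t := by
  obtain ⟨U, hreg, hU⟩ := h.exists_amplitude
  have hV := integrableOn_evolvedAmplitude (p₂ := p₂) hμ₀ h.continuousOn t
  ext φ
  obtain ⟨ψ, rfl, hψ⟩ := exists_angularFourierCLM_eq φ
  have h1 : u t (angularFourierCLM ψ) = angularFourier (u t) ψ := rfl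
  rw [h1, angularFourier_solution_apply hu ht, hU, Lp.toTemperedDistribution_apply]
  have h2 : ∫ x : ℝ, angularFourierCLM ψ x • (wave hμ₀ h.continuousOn t) x
      = ∫ x : ℝ, angularFourierCLM ψ x * bandInvFourier p₁ p₂ (evolvedAmplitude p₁ μ ut t) x := by
    refine integral_congr_ae ?_
    filter_upwards [(memLp_bandInvFourier hV).coeFn_toLp] with x hx
    rw [smul_eq_mul]
    congr 1
  rw [h2, integral_mul_bandInvFourier hV (angularFourierCLM ψ).integrable]
  refine setIntegral_congr_fun measurableSet_Ioc fun p hpI => ?_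
  rw [← hψ, chirpCLM_apply, hreg.factor p hpI, evolvedAmplitude]
  ring

theorem norm_wave_le (hp : p₁ < p₂) (hμ₀ : 0 < μ) (hμ₁ : μ ≤ 1)
    (h : BandCondition p₁ p₂ μ u₀ ut) {t : ℝ} (ht : 0 < t) :
    ‖wave hμ₀ h.continuousOn t‖ ≤ constInside p₁ p₂ μ ut * t ^ (-(μ / 2)) := by
  obtain ⟨U, hreg, _⟩ := h.exists_amplitude
  rw [wave, Lp.norm_toLp]
  refine ENNReal.toReal_le_of_le_ofReal (mul_nonneg (constInside_pos hμ₀ (h.supNorm_pos hp)).le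
    (Real.rpow_nonneg ht.le _)) ?_
  rw [eLpNorm_exponent_top]
  exact eLpNormEssSup_le_of_ae_bound (Eventually.of_forall
    (norm_bandInvFourier_evolvedAmplitude_le hp hμ₀ hμ₁ hreg.continuousOn hreg.differentiableOn
      hreg.integrableOn_deriv ht))

theorem exists_norm_wave_ge (hp : p₁ < p₂) (hμ₀ : 0 < μ) (h : BandCondition p₁ p₂ μ u₀ ut) :
    ∃ c : ℝ, 0 < c ∧ ∀ t : ℝ, 1 ≤ t →
      c * t ^ (-(μ / 2)) ≤ ‖wave hμ₀ h.continuousOn t‖ := by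
  obtain ⟨q, hq, hut⟩ : ∃ q, (q = p₁ ∨ (μ = 1 ∧ q ∈ Ioo p₁ p₂)) ∧ ut q ≠ 0 := by
    by_cases hμ : μ = 1
    · obtain ⟨q, hqI, hq⟩ := h.exists_ne_zero hp
      exact ⟨q, Or.inr ⟨hμ, hqI⟩, hq⟩
    · obtain ⟨_, hreg, _⟩ := h.exists_amplitude
      exact ⟨p₁, Or.inl rfl, hreg.ne_zero hμ⟩
  obtain ⟨c, hc, hlow⟩ := exists_lower_bound hp hμ₀ h.continuousOn hut hq
  refine ⟨c, hc, fun t ht => ?_⟩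
  rw [wave, Lp.norm_toLp]
  exact hlow t ht _ (ae_norm_le_toReal_eLpNorm_top (memLp_bandInvFourier
    (integrableOn_evolvedAmplitude hμ₀ h.continuousOn t)))

end Band

end FreeSchrodinger

end

theorem theorem2p5 (p₁ p₂ μ : ℝ) (hp : p₁ < p₂) (hμ₀ : 0 < μ) (hμ₁ : μ ≤ 1)
    (u₀ : 𝓢'(ℝ, ℂ)) (ut : ℝ → ℂ)
    (hu₀ : FreeSchrodinger.BandCondition p₁ p₂ μ u₀ ut)
    (u : ℝ → 𝓢'(ℝ, ℂ)) (hu : FreeSchrodinger.IsSolution u₀ u) :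
    ∃ uS : ℝ → Lp ℂ ∞ (volume : Measure ℝ),
      (∀ t : ℝ, 0 < t → Lp.toTemperedDistribution (uS t) = u t) ∧
      (∀ q₁ q₂ : ℝ, q₁ < p₁ → p₂ < q₂ → 0 < FreeSchrodinger.decayConst p₁ p₂ q₁ q₂ μ ut ∧
        ∀ t : ℝ, 1 ≤ t →
          ‖uS t‖ ≤ FreeSchrodinger.decayConst p₁ p₂ q₁ q₂ μ ut * t ^ (-(μ / 2))) ∧
      (∃ c : ℝ, 0 < c ∧ ∀ t : ℝ, 1 ≤ t → c * t ^ (-(μ / 2)) ≤ ‖uS t‖) := by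
  refine ⟨FreeSchrodinger.wave hμ₀ hu₀.continuousOn,
    fun t ht => FreeSchrodinger.toTemperedDistribution_wave hμ₀ hu₀ hu ht, fun q₁ q₂ hq₁ hq₂ => ?_,
    FreeSchrodinger.exists_norm_wave_ge hp hμ₀ hu₀⟩
  have hM := hu₀.supNorm_pos hp
  have h₀ := FreeSchrodinger.constInside_pos hμ₀ hM
  have h₁ := FreeSchrodinger.constSide_pos hμ₀ hM (m := 2 * (q₂ - p₂)) (by linarith)
  have h₂ := FreeSchrodinger.constSide_pos hμ₀ hM (m := 2 * (p₁ - q₁)) (by linarith)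
  refine ⟨add_pos h₀ (add_pos h₁ h₂), fun t ht => ?_⟩
  have ht₀ : 0 < t := one_pos.trans_le ht
  refine (FreeSchrodinger.norm_wave_le hp hμ₀ hμ₁ hu₀ ht₀).trans
    (mul_le_mul_of_nonneg_right ?_ (Real.rpow_nonneg ht₀.le _))
  -- The uniform bound uses `constInside` only, and the side constants are positive.
  exact le_add_of_nonneg_right (add_pos h₁ h₂).le
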